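/- For integers $n,g\ge 0$ let $A(n,g)$ be the number of rooted one-face maps of genus $g$ with $n$ edges, up to equivalence. Here a rooted one-face map with $n$ edges is given by a triple $(\alpha,\beta,\gamma)$ of permutations of the set $\{1,\dots,2n\}$ of half-edges, where $\alpha$ is an involution without fixed points (its cycles are the edges), the cycles of $\beta$ are the vertices with their cyclic orders of half-edges, $\gamma=\alpha\beta$ (first $\beta$, then $\alpha$) is a single cycle through all $2n$ half-edges, and the half-edge $1$ is the root. Two triples $(\alpha,\beta,\gamma)$ and $(\alpha',\beta',\gamma')$ are equivalent if there is a permutation $\pi$ with $\alpha'=\pi\alpha\pi^{-1}$, $\gamma'=\pi\gamma\pi^{-1}$ and $\pi(1)=1$. For $n=0$ the only such map is the single vertex on the sphere. The genus $g$ is determined by $v-n+1=2-2g$, where $v$ is the number of vertices. Let $C(m,k)$ be the number of permutations of $m$ elements with exactly $k$ cycles, fixed points counted as cycles (the unsigned Stirling number of the first kind). Then for all $n,g\ge 0$ $$A(n,g)=\frac{(2n)!}{2^n\,n!\,(n+1)!}\,\bar A(n,g),\qquad \bar A(n,g)=\sum_{k=0}^n\binom nk\sum_{\substack{i,j\ge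 0\\ i+j=n+2-2g}}C(n-k+1,i)\,(-1)^{k+1-j}\,C(k+1,j),$$ the inner sum being empty if $n+2-2g<0$. -/

import Mathlib

/-- The number of cycles of a permutation, fixed points being counted as cycles of length one. -/
noncomputable def numCycles {X : Type*} (σ : Equiv.Perm X) : ℕ :=
  Nat.card (Quotient (Equiv.Perm.SameCycle.setoid σ))

/-- `permCount n k` is the number `C(n,k)` of permutations of `n` elements with exactly `k` cycles
(the unsigned Stirling number of the first kind). -/
noncomputable def permCount (n k : ℕ) : ℕ :=
  Nat.card {σ : Equiv.Perm (Fin n) // numCycles σ = k}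

/-- A one-face map (fatgraph with one boundary component) with `n` edges, whose `2n` half-edges are
labelled by `Fin (2 * n)`. The label `0` (if there is a half-edge at all) is the root. -/
structure LabelledOneFaceMap (n : ℕ) where
  /-- exchanges the two half-edges of every edge -/
  alpha : Equiv.Perm (Fin (2 * n))
  /-- the cyclic order of the half-edges around every vertex -/
  beta : Equiv.Perm (Fin (2 * n))
  /-- the boundary walk -/
  gamma : Equiv.Perm (Fin (2 * n))
  alpha_invol : ∀ x, alpha (alpha x) = x
  alpha_ne : ∀ x, alpha x ≠ x
  gamma_eq : gamma = alpha * beta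
  /-- the boundary walk is one long cycle through all the half-edges -/
  gamma_cycle : ∀ x y, gamma.SameCycle x y

namespace LabelledOneFaceMap

/-- The number of vertices. The cycles of `beta` are the vertices, except that the map without
edges consists of one isolated vertex, to which no half-edge is attached. -/
noncomputable def numVertices {n : ℕ} (M : LabelledOneFaceMap n) : ℕ :=
  if n = 0 then 1 else numCycles M.beta

/-- `M` has genus `g`: Euler's formula `v - n + 1 = 2 - 2 g`. -/
def HasGenus {n : ℕ} (M : LabelledOneFaceMap n) (g : ℕ) : Prop :=
  (M.numVertices : ℤ) - n + 1 = 2 - 2 * g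

/-- Two labelled maps are the same rooted map if a relabelling that fixes the root carries one to
the other. -/
def Equivalent {n : ℕ} (M N : LabelledOneFaceMap n) : Prop :=
  ∃ p : Equiv.Perm (Fin (2 * n)), N.alpha = p * M.alpha * p⁻¹ ∧ N.gamma = p * M.gamma * p⁻¹ ∧
    ∀ x : Fin (2 * n), x.val = 0 → p x = x

theorem equivalent_equivalence (n : ℕ) :
    Equivalence (Equivalent : LabelledOneFaceMap n → LabelledOneFaceMap n → Prop) where
  refl M := ⟨1, by simp, by simp, by simp⟩
  symm := by
    rintro M N ⟨p, h1, h2, h3⟩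
    refine ⟨p⁻¹, ?_, ?_, fun x hx => ?_⟩
    · rw [h1]; group
    · rw [h2]; group
    · rw [Equiv.Perm.inv_eq_iff_eq, h3 x hx]
  trans := by
    rintro M N K ⟨p, h1, h2, h3⟩ ⟨q, k1, k2, k3⟩
    refine ⟨q * p, ?_, ?_, fun x hx => ?_⟩
    · rw [k1, h1]; group
    · rw [k2, h2]; group
    · rw [Equiv.Perm.mul_apply, h3 x hx, k3 x hx]

end LabelledOneFaceMap

/-- Equivalence of the labelled one-face maps with `n` edges and genus `g`. -/
def rootedMapSetoid (n g : ℕ) : Setoid {M : LabelledOneFaceMap n // M.HasGenus g} where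
  r M N := LabelledOneFaceMap.Equivalent M.1 N.1
  iseqv := ⟨fun M => (LabelledOneFaceMap.equivalent_equivalence n).refl M.1,
    fun h => (LabelledOneFaceMap.equivalent_equivalence n).symm h,
    fun h k => (LabelledOneFaceMap.equivalent_equivalence n).trans h k⟩

/-- `A(n,g)`: the number of rooted one-face maps of genus `g` with `n` edges, up to equivalence. -/
noncomputable def numRootedOneFaceMaps (n g : ℕ) : ℕ :=
  Nat.card (Quotient (rootedMapSetoid n g))

/-- The sum over `k` and over all `i, j ≥ 0` with `i + j = n + 2 - 2 g` of
`binom(n,k) C(n-k+1,i) (-1)^(k+1-j) C(k+1,j)`; the inner sum is empty if `n + 2 < 2 g`. -/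
noncomputable def barA (n g : ℕ) : ℚ :=
  ∑ k ∈ Finset.range (n + 1), (n.choose k : ℚ) *
    ∑ p ∈ (Finset.range (n + 3) ×ˢ Finset.range (n + 3)).filter
        (fun p => p.1 + p.2 + 2 * g = n + 2),
      (permCount (n - k + 1) p.1 : ℚ) * (-1 : ℚ) ^ ((k : ℤ) + 1 - (p.2 : ℤ)) *
        (permCount (k + 1) p.2 : ℚ)

open Equiv Equiv.Perm

/-! ### Counting cycles -/

/-! A labelled map is a pair of a fixed-point-free involution α and a long cycle γ, and its vertices
are the cycles of αγ. Relabellings that fix the root act freely, so labelled maps are counted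
instead, with weight x to the number of vertices. All such α are conjugate, so one standard flip
suffices.

Long cycles are detected by inclusion-exclusion: an invariant set S is a union of cycles of γ, and a
cycle of length l contributes (-1)^l times its sign, which is -1. Summing over the S that avoid a
point r therefore gives 1 for a long cycle and 0 otherwise (`sum_signed_signOn`). For each S there
remains a sum over the Young subgroup of S (`youngSum`), which transforms by the sign on S under
multiplication by that subgroup on either side. It vanishes if the flip moves two points of S out of
S (`youngSum_eq_zero`). The surviving S are unions of edges, or such a union with one more
half-edge; for these the sum reduces to a falling times a rising factorial (`youngSum_one`,
`mul_youngSum_swap`).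

At x = N these products are coefficients of X^k / (1 - X)^m, and the alternating sum collapses to X
(1 + X)^(n+1) / (1 - X)^(n+3) (`alternating_geom_identity`). Expanding the binomial gives the
generating polynomial of `barA` up to a constant, and comparing coefficients finishes the proof. -/

theorem sameCycle_permCongr {X Y : Type*} (e : X ≃ Y) (σ : Perm X) (a b : X) :
    SameCycle (e.permCongr σ) (e a) (e b) ↔ SameCycle σ a b := by
  have key : ∀ i : ℤ, ((e.permCongr σ) ^ i) (e a) = e ((σ ^ i) a) := by
    intro i
    have : (e.permCongr σ) ^ i = e.permCongr (σ ^ i) := (map_zpow e.permCongrHom σ i).symm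
    simp [this]
  simp only [SameCycle, key, e.apply_eq_iff_eq]

theorem numCycles_permCongr {X Y : Type*} (e : X ≃ Y) (σ : Perm X) :
    numCycles (e.permCongr σ) = numCycles σ :=
  (Nat.card_congr (Quotient.congr e fun a b => (sameCycle_permCongr e σ a b).symm)).symm

theorem numCycles_conj {X : Type*} (p σ : Perm X) : numCycles (p * σ * p⁻¹) = numCycles σ :=
  numCycles_permCongr p σ

theorem numCycles_mul_comm {X : Type*} (σ τ : Perm X) : numCycles (σ * τ) = numCycles (τ * σ) := by
  rw [← numCycles_conj τ (σ * τ)]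
  congr 1
  group

theorem sameCycle_sumCongr_inl {X Y : Type*} {σ : Perm X} {τ : Perm Y} {a b : X} :
    SameCycle (Perm.sumCongr σ τ) (Sum.inl a) (Sum.inl b) ↔ SameCycle σ a b := by
  have key : ∀ i : ℤ, ((Perm.sumCongr σ τ) ^ i) (Sum.inl a) = Sum.inl ((σ ^ i) a) := by
    intro i
    have : (Perm.sumCongr σ τ) ^ i = Perm.sumCongr (σ ^ i) (τ ^ i) :=
      (map_zpow (sumCongrHom X Y) (σ, τ) i).symm
    simp [this]
  simp only [SameCycle, key, Sum.inl.injEq]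

theorem sameCycle_sumCongr_inr {X Y : Type*} {σ : Perm X} {τ : Perm Y} {a b : Y} :
    SameCycle (Perm.sumCongr σ τ) (Sum.inr a) (Sum.inr b) ↔ SameCycle τ a b := by
  have key : ∀ i : ℤ, ((Perm.sumCongr σ τ) ^ i) (Sum.inr a) = Sum.inr ((τ ^ i) a) := by
    intro i
    have : (Perm.sumCongr σ τ) ^ i = Perm.sumCongr (σ ^ i) (τ ^ i) :=
      (map_zpow (sumCongrHom X Y) (σ, τ) i).symm
    simp [this]
  simp only [SameCycle, key, Sum.inr.injEq]

theorem not_sameCycle_sumCongr {X Y : Type*} {σ : Perm X} {τ : Perm Y} {a : X} {b : Y} :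
    ¬ SameCycle (Perm.sumCongr σ τ) (Sum.inl a) (Sum.inr b) := by
  rintro ⟨i, hi⟩
  have : (Perm.sumCongr σ τ) ^ i = Perm.sumCongr (σ ^ i) (τ ^ i) :=
    (map_zpow (sumCongrHom X Y) (σ, τ) i).symm
  simp [this] at hi

theorem numCycles_sumCongr {X Y : Type*} [Finite X] [Finite Y] (σ : Perm X) (τ : Perm Y) :
    numCycles (Perm.sumCongr σ τ) = numCycles σ + numCycles τ := by
  rw [numCycles, numCycles, numCycles, ← Nat.card_sum]
  let f : Quotient (SameCycle.setoid σ) ⊕ Quotient (SameCycle.setoid τ) →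
      Quotient (SameCycle.setoid (Perm.sumCongr σ τ)) :=
    Sum.elim (Quotient.map Sum.inl fun a b h => sameCycle_sumCongr_inl.2 h)
      (Quotient.map Sum.inr fun a b h => sameCycle_sumCongr_inr.2 h)
  refine (Nat.card_eq_of_bijective f ⟨?_, ?_⟩).symm
  · rintro (a | a) (b | b) h
    all_goals
      induction a using Quotient.inductionOn
      induction b using Quotient.inductionOn
      replace h := Quotient.exact h
    · exact congrArg _ (Quotient.sound (sameCycle_sumCongr_inl.1 h))
    · exact (not_sameCycle_sumCongr h).elim
    · exact (not_sameCycle_sumCongr h.symm).elim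
    · exact congrArg _ (Quotient.sound (sameCycle_sumCongr_inr.1 h))
  · intro q
    induction q using Quotient.inductionOn with
    | h x =>
      rcases x with x | x
      · exact ⟨Sum.inl ⟦x⟧, rfl⟩
      · exact ⟨Sum.inr ⟦x⟧, rfl⟩

theorem numCycles_subtypeCongr {X : Type*} [Finite X] {p : X → Prop} [DecidablePred p]
    (σ : Perm {x // p x}) (τ : Perm {x // ¬ p x}) :
    numCycles (σ.subtypeCongr τ) = numCycles σ + numCycles τ := by
  rw [Perm.subtypeCongr, numCycles_permCongr]
  exact numCycles_sumCongr σ τ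

theorem numCycles_one {X : Type*} : numCycles (1 : Perm X) = Nat.card X := by
  refine (Nat.card_eq_of_bijective (fun x => (⟦x⟧ : Quotient (SameCycle.setoid (1 : Perm X))))
    ⟨fun a b h => sameCycle_one.1 (Quotient.exact h), Quotient.mk_surjective⟩).symm

theorem numCycles_optionCongr {X : Type*} [Finite X] (σ : Perm X) :
    numCycles (optionCongr σ) = numCycles σ + 1 := by
  have h : (optionEquivSumPUnit X).permCongr (optionCongr σ) =
      Perm.sumCongr σ (1 : Perm PUnit.{1}) := by
    ext x
    rcases x with x | x <;> simp
  rw [← numCycles_permCongr (optionEquivSumPUnit.{0} X), h, numCycles_sumCongr, numCycles_one]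
  simp

/-! ### Joining two cycles by a transposition -/

section Merge

variable {X : Type*} [DecidableEq X] {σ : Perm X} {a b : X}

/-- The new permutation follows σ until the first arrival at a, which is redirected to b; the path
cannot meet b earlier because b lies on another cycle. -/
theorem sameCycle_swap_mul_of_pow_eq (hab : ¬ SameCycle σ a b) (k : ℕ) :
    ∀ x, (σ ^ (k + 1)) x = a → SameCycle (swap a b * σ) x b := by
  induction k with
  | zero =>
    intro x hx
    refine ⟨1, ?_⟩
    simp only [zero_add, pow_one] at hx
    simp [hx]
  | succ k ih =>
    intro x hx
    by_cases h : σ x = a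
    · exact ⟨1, by simp [h]⟩
    · have hb : σ x ≠ b := by
        intro h'
        refine hab ?_
        rw [← hx, ← h', pow_succ, Perm.mul_apply, sameCycle_pow_left]
      have h1 : (swap a b * σ) x = σ x := by
        rw [Perm.mul_apply, swap_apply_of_ne_of_ne h hb]
      have h2 := ih (σ x) (by rw [← hx, pow_succ σ (k + 1), Perm.mul_apply])
      rw [← h1, sameCycle_apply_left] at h2
      exact h2

theorem sameCycle_swap_mul_left [Finite X] (hab : ¬ SameCycle σ a b) {x : X}
    (hx : SameCycle σ x a) : SameCycle (swap a b * σ) x b := by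
  obtain ⟨k, hk, -, h⟩ := hx.exists_pow_eq''
  obtain ⟨k, rfl⟩ := Nat.exists_eq_add_of_lt hk
  exact sameCycle_swap_mul_of_pow_eq hab k x (by simpa using h)

theorem sameCycle_swap_mul_right [Finite X] (hab : ¬ SameCycle σ a b) {x : X}
    (hx : SameCycle σ x b) : SameCycle (swap a b * σ) x a := by
  rw [swap_comm]
  exact sameCycle_swap_mul_left (fun h => hab h.symm) hx

theorem sameCycle_swap_mul_of_ne {x : X} (ha : ¬ SameCycle σ x a) (hb : ¬ SameCycle σ x b)
    (k : ℕ) : SameCycle (swap a b * σ) x ((σ ^ k) x) := by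
  induction k with
  | zero => exact SameCycle.rfl
  | succ k ih =>
    have h1 : (swap a b * σ) ((σ ^ k) x) = (σ ^ (k + 1)) x := by
      rw [Perm.mul_apply, ← Perm.mul_apply σ, ← pow_succ', swap_apply_of_ne_of_ne]
      · rintro h
        exact ha (h ▸ sameCycle_pow_right.2 SameCycle.rfl)
      · rintro h
        exact hb (h ▸ sameCycle_pow_right.2 SameCycle.rfl)
    rw [← h1, sameCycle_apply_right]
    exact ih

theorem SameCycle.swap_mul [Finite X] (hab : ¬ SameCycle σ a b) {x y : X} (h : SameCycle σ x y) :
    SameCycle (Equiv.swap a b * σ) x y := by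
  by_cases ha : SameCycle σ x a
  · exact (sameCycle_swap_mul_left hab ha).trans
      (sameCycle_swap_mul_left hab (h.symm.trans ha)).symm
  by_cases hb : SameCycle σ x b
  · exact (sameCycle_swap_mul_right hab hb).trans
      (sameCycle_swap_mul_right hab (h.symm.trans hb)).symm
  obtain ⟨k, -, -, rfl⟩ := h.exists_pow_eq''
  exact sameCycle_swap_mul_of_ne ha hb k

/-- A step differs from a σ-step only when σ lands on a or b, so no cycles other than those of a and
b can be joined. -/
theorem sameCycle_or_of_pow_swap_mul (x : X) (k : ℕ) :
    SameCycle σ x (((swap a b * σ) ^ k) x) ∨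
      (SameCycle σ x a ∨ SameCycle σ x b) ∧
        (SameCycle σ (((swap a b * σ) ^ k) x) a ∨ SameCycle σ (((swap a b * σ) ^ k) x) b) := by
  induction k with
  | zero => exact Or.inl SameCycle.rfl
  | succ k ih =>
    rw [pow_succ', Perm.mul_apply]
    set y := ((swap a b * σ) ^ k) x
    rw [Perm.mul_apply]
    by_cases ha : σ y = a
    · rw [ha, swap_apply_left]
      have : SameCycle σ y a := ha ▸ sameCycle_apply_right.2 SameCycle.rfl
      right
      refine ⟨?_, Or.inr SameCycle.rfl⟩
      rcases ih with h | h
      · exact Or.inl (h.trans this)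
      · exact h.1
    by_cases hb : σ y = b
    · rw [hb, swap_apply_right]
      have : SameCycle σ y b := hb ▸ sameCycle_apply_right.2 SameCycle.rfl
      right
      refine ⟨?_, Or.inl SameCycle.rfl⟩
      rcases ih with h | h
      · exact Or.inr (h.trans this)
      · exact h.1
    rw [swap_apply_of_ne_of_ne ha hb, sameCycle_apply_right, sameCycle_apply_left,
      sameCycle_apply_left]
    exact ih

theorem numCycles_swap_mul [Finite X] (hab : ¬ SameCycle σ a b) :
    numCycles (swap a b * σ) + 1 = numCycles σ := by
  classical
  let b' : Quotient (SameCycle.setoid σ) := ⟦b⟧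
  -- The cycle of b is absorbed by that of a, so the old cycles other than that of b biject with the
  -- new cycles.
  let f : {q : Quotient (SameCycle.setoid σ) // q ≠ b'} →
      Quotient (SameCycle.setoid (swap a b * σ)) :=
    fun q => Quotient.map id (fun x y h => SameCycle.swap_mul hab h) q.1
  have hf : Function.Bijective f := by
    constructor
    · rintro ⟨x, hx⟩ ⟨y, hy⟩ h
      induction x using Quotient.inductionOn
      induction y using Quotient.inductionOn
      rename_i x y
      replace hx : ¬ SameCycle σ x b := fun h => hx (Quotient.sound h)
      replace hy : ¬ SameCycle σ y b := fun h => hy (Quotient.sound h)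
      have h' : SameCycle (swap a b * σ) x y := Quotient.exact h
      obtain ⟨k, -, -, hk⟩ := h'.exists_pow_eq''
      have := sameCycle_or_of_pow_swap_mul (σ := σ) (a := a) (b := b) x k
      rw [hk] at this
      refine Subtype.ext (Quotient.sound ?_)
      change SameCycle σ x y
      rcases this with h | ⟨h1, h2⟩
      · exact h
      · exact (h1.resolve_right hx).trans (h2.resolve_right hy).symm
    · intro q
      induction q using Quotient.inductionOn with
      | h x =>
        by_cases hx : SameCycle σ x b
        · exact ⟨⟨⟦a⟧, fun h => hab (Quotient.exact h)⟩,
            Quotient.sound (sameCycle_swap_mul_right hab hx).symm⟩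
        · exact ⟨⟨⟦x⟧, fun h => hx (Quotient.exact h)⟩, rfl⟩
  rw [numCycles, ← Nat.card_eq_of_bijective f hf, numCycles]
  have := Fintype.ofFinite (Quotient (SameCycle.setoid σ))
  rw [Nat.card_eq_fintype_card, Nat.card_eq_fintype_card, Fintype.card_subtype_compl,
    Fintype.card_subtype_eq]
  have : 0 < Fintype.card (Quotient (SameCycle.setoid σ)) := Fintype.card_pos_iff.2 ⟨b'⟩
  omega

end Merge

/-! ### Cycle index sums -/

theorem sum_perm_sign_pow_mul_pow_numCycles_congr {X Y : Type*} [Fintype X] [DecidableEq X]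
    [Fintype Y] [DecidableEq Y] (f : X ≃ Y) (e : ℕ) (x : ℚ) :
    ∑ σ : Perm X, ((sign σ : ℤ) : ℚ) ^ e * x ^ numCycles σ =
      ∑ σ : Perm Y, ((sign σ : ℤ) : ℚ) ^ e * x ^ numCycles σ := by
  refine Fintype.sum_equiv f.permCongr _ _ fun σ => ?_
  rw [sign_permCongr, numCycles_permCongr]

/-- Adding a point to m points either creates a fixed point (factor x) or inserts it into a cycle
next to one of the m points, which keeps the number of cycles and flips the sign. The exponent e = 0
gives rising and e = 1 falling factorials. -/
theorem sum_perm_fin_sign_pow_mul_pow_numCycles (m e : ℕ) (x : ℚ) :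
    ∑ σ : Perm (Fin m), ((sign σ : ℤ) : ℚ) ^ e * x ^ numCycles σ =
      ∏ i ∈ Finset.range m, (x + (-1) ^ e * i) := by
  induction m with
  | zero =>
    simp [numCycles]
  | succ m ih =>
    rw [sum_perm_sign_pow_mul_pow_numCycles_congr (finSuccEquiv m),
      Fintype.sum_equiv (decomposeOption (α := Fin m)) _
        (fun p => ((sign (swap none p.1 * optionCongr p.2) : ℤ) : ℚ) ^ e *
          x ^ numCycles (swap none p.1 * optionCongr p.2))
        (fun σ => by rw [← decomposeOption_symm_apply, symm_apply_apply]),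
      Fintype.sum_prod_type, Fintype.sum_option, Finset.prod_range_succ, ← ih, mul_add]
    congr 1
    · rw [Finset.sum_mul]
      refine Finset.sum_congr rfl fun σ _ => ?_
      simp only [swap_self, ← Perm.one_def, one_mul, optionCongr_sign, numCycles_optionCongr]
      ring
    · have : ∀ i : Fin m, ∑ σ : Perm (Fin m),
          ((sign (swap none (some i) * optionCongr σ) : ℤ) : ℚ) ^ e *
            x ^ numCycles (swap none (some i) * optionCongr σ) =
          ∑ σ : Perm (Fin m), (-1) ^ e * (((sign σ : ℤ) : ℚ) ^ e * x ^ numCycles σ) := by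
        intro i
        refine Finset.sum_congr rfl fun σ _ => ?_
        have h1 : ¬ SameCycle (optionCongr σ) none (some i) := fun h => by
          have := h.eq_of_left (by simp [Function.IsFixedPt])
          simp at this
        have h2 := numCycles_swap_mul h1
        rw [numCycles_optionCongr, Nat.add_right_cancel_iff] at h2
        rw [h2, Perm.sign_mul, Perm.sign_swap (by simp), optionCongr_sign]
        push_cast
        ring
      simp only [this, Finset.sum_const, Finset.card_univ, Fintype.card_fin, ← Finset.mul_sum,
        nsmul_eq_mul]
      ring

theorem sum_perm_sign_pow_mul_pow_numCycles {X : Type*} [Fintype X] [DecidableEq X]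
    (e : ℕ) (x : ℚ) :
    ∑ σ : Perm X, ((sign σ : ℤ) : ℚ) ^ e * x ^ numCycles σ =
      ∏ i ∈ Finset.range (Fintype.card X), (x + (-1) ^ e * i) := by
  rw [sum_perm_sign_pow_mul_pow_numCycles_congr (Fintype.equivFin X),
    sum_perm_fin_sign_pow_mul_pow_numCycles]

/-! ### The sign of a permutation on an invariant subset -/

section SignOn

variable {X : Type*}

theorem invariant_of_fixes_compl {S : Finset X} {δ : Perm X} (h : ∀ x, x ∉ S → δ x = x) (x : X) :
    δ x ∈ S ↔ x ∈ S := by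
  constructor
  · intro hx
    by_contra hx'
    exact hx' (h x hx' ▸ hx)
  · intro hx
    by_contra hx'
    exact hx' ((δ.injective (h _ hx')).symm ▸ hx)

variable [Fintype X] [DecidableEq X]

/-- The sign of the restriction of `γ` to `S`, or zero if `S` is not invariant under `γ`. -/
def signOn (S : Finset X) (γ : Perm X) : ℚ :=
  if h : ∀ x, γ x ∈ S ↔ x ∈ S then ((sign (γ.subtypePerm h) : ℤ) : ℚ) else 0

theorem signOn_of_invariant {S : Finset X} {γ : Perm X} (h : ∀ x, γ x ∈ S ↔ x ∈ S) :
    signOn S γ = ((sign (ofSubtype (γ.subtypePerm h)) : ℤ) : ℚ) := by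
  rw [signOn, dif_pos h, sign_ofSubtype]

theorem signOn_of_not_invariant {S : Finset X} {γ : Perm X} (h : ¬ ∀ x, γ x ∈ S ↔ x ∈ S) :
    signOn S γ = 0 :=
  dif_neg h

/-- Invariance is needed for one factor only: when δ preserves S, the product does so exactly if γ
does, and otherwise both sides are zero. -/
theorem signOn_mul {S : Finset X} (γ : Perm X) {δ : Perm X} (hδ : ∀ x, δ x ∈ S ↔ x ∈ S) :
    signOn S (γ * δ) = signOn S γ * signOn S δ := by
  by_cases h : ∀ x, γ x ∈ S ↔ x ∈ S
  · have h' : ∀ x, (γ * δ) x ∈ S ↔ x ∈ S := fun x => by rw [Perm.mul_apply, h, hδ]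
    rw [signOn, signOn, signOn, dif_pos h, dif_pos h', dif_pos hδ]
    have : (γ * δ).subtypePerm h' = γ.subtypePerm h * δ.subtypePerm hδ := by
      rfl
    rw [this, Perm.sign_mul]
    push_cast
    ring
  · have h' : ¬ ∀ x, (γ * δ) x ∈ S ↔ x ∈ S := fun h' => h fun x => by
      have := h' (δ⁻¹ x)
      rw [← hδ (δ⁻¹ x)] at this
      simpa using this
    rw [signOn_of_not_invariant h, signOn_of_not_invariant h', zero_mul]

theorem invariant_of_fixes {S : Finset X} {δ : Perm X} (h : ∀ x, x ∈ S → δ x = x) (x : X) :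
    δ x ∈ S ↔ x ∈ S := by
  have := invariant_of_fixes_compl (S := Sᶜ) (δ := δ) (fun x hx => h x (by simpa using hx)) x
  simpa [not_iff_not] using this

theorem signOn_of_fixes_compl {S : Finset X} {δ : Perm X} (h : ∀ x, x ∉ S → δ x = x) :
    signOn S δ = ((sign δ : ℤ) : ℚ) := by
  rw [signOn, dif_pos (invariant_of_fixes_compl h)]
  have := sign_subtypePerm (p := (· ∈ S)) δ (invariant_of_fixes_compl h)
    (fun x hx => by_contra fun hx' => hx (h x hx'))
  rw [← this]
  congr!

theorem signOn_of_fixes {S : Finset X} {δ : Perm X} (h : ∀ x, x ∈ S → δ x = x) :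
    signOn S δ = 1 := by
  rw [signOn, dif_pos (invariant_of_fixes h)]
  have : δ.subtypePerm (invariant_of_fixes h) = 1 := by
    ext x
    simpa using h x.1 x.2
  simp [this]

theorem signOn_disjoint_union {S T : Finset X} {γ : Perm X} (hS : ∀ x, γ x ∈ S ↔ x ∈ S)
    (hT : ∀ x, γ x ∈ T ↔ x ∈ T) (hST : Disjoint S T) :
    signOn (S ∪ T) γ = signOn S γ * signOn T γ := by
  have h : ∀ x, γ x ∈ S ∪ T ↔ x ∈ S ∪ T := fun x => by
    rw [Finset.mem_union, Finset.mem_union, hS, hT]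
  rw [signOn_of_invariant h, signOn_of_invariant hS, signOn_of_invariant hT]
  have : ofSubtype (γ.subtypePerm h) =
      ofSubtype (γ.subtypePerm hS) * ofSubtype (γ.subtypePerm hT) := by
    ext x
    rw [Perm.mul_apply]
    by_cases hx : x ∈ S
    · have hx' : x ∉ T := Finset.disjoint_left.1 hST hx
      rw [ofSubtype_apply_of_mem _ (Finset.mem_union_left T hx),
        ofSubtype_apply_of_not_mem (p := (· ∈ T)) _ hx', ofSubtype_apply_of_mem _ hx]
      simp
    · by_cases hx' : x ∈ T
      · have : γ x ∉ S := fun h => hx ((hS x).1 h)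
        rw [ofSubtype_apply_of_mem _ (Finset.mem_union_right S hx'),
          ofSubtype_apply_of_mem _ hx']
        simp only [subtypePerm_apply]
        rw [ofSubtype_apply_of_not_mem (p := (· ∈ S)) _ this]
      · rw [ofSubtype_apply_of_not_mem (p := (· ∈ S ∪ T)) _ (by simp [hx, hx']),
          ofSubtype_apply_of_not_mem (p := (· ∈ T)) _ hx',
          ofSubtype_apply_of_not_mem (p := (· ∈ S)) _ hx]
  rw [this, Perm.sign_mul]
  push_cast
  ring

/-- A cycle of length l has sign (-1)^(l-1). Fixed points are treated apart, since `IsCycle`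
excludes them. -/
theorem signOn_cycle (γ : Perm X) (y : X) {c : Finset X} (hc : ∀ x, x ∈ c ↔ SameCycle γ y x) :
    (-1) ^ c.card * signOn c γ = -1 := by
  have hinv : ∀ x, γ x ∈ c ↔ x ∈ c := fun x => by rw [hc, hc, sameCycle_apply_right]
  have : ofSubtype (γ.subtypePerm hinv) = γ.cycleOf y := by
    ext x
    by_cases hx : x ∈ c
    · rw [ofSubtype_apply_of_mem _ hx, ((hc x).1 hx).cycleOf_apply]
      simp
    · rw [ofSubtype_apply_of_not_mem (p := (· ∈ c)) _ hx,
        cycleOf_apply_of_not_sameCycle fun h => hx ((hc x).2 h)]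
  rw [signOn_of_invariant hinv, this]
  by_cases hy : γ y = y
  · have h1 : c = {y} := by
      ext x
      rw [hc, Finset.mem_singleton]
      exact ⟨fun h => (h.eq_of_left hy).symm, fun h => h ▸ SameCycle.rfl⟩
    rw [(cycleOf_eq_one_iff γ).2 hy, h1]
    simp
  · have h1 : (γ.cycleOf y).support = c := by
      ext x
      rw [mem_support_cycleOf_iff' hy, hc]
    rw [(isCycle_cycleOf γ hy).sign, h1]
    push_cast
    rw [mul_neg, ← mul_pow]
    simp

/-- Adding or removing a whole cycle keeps (non-)invariance and changes the signed weight by the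
factor -1. This supplies the sign-reversing involution of `sum_signed_signOn`. -/
theorem signed_signOn_symmDiff_cycle (γ : Perm X) (y : X) {c : Finset X}
    (hc : ∀ x, x ∈ c ↔ SameCycle γ y x) (S : Finset X) :
    (-1) ^ (symmDiff S c).card * signOn (symmDiff S c) γ = -((-1) ^ S.card * signOn S γ) := by
  have hinv : ∀ x, γ x ∈ c ↔ x ∈ c := fun x => by rw [hc, hc, sameCycle_apply_right]
  have key : ∀ S : Finset X, y ∉ S → (∀ x, γ x ∈ S ↔ x ∈ S) →
      (-1) ^ (symmDiff S c).card * signOn (symmDiff S c) γ = -((-1) ^ S.card * signOn S γ) := by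
    intro S hy hS
    have hd : Disjoint S c := by
      refine Finset.disjoint_left.2 fun x hx hxc => hy ?_
      obtain ⟨k, -, -, rfl⟩ := ((hc x).1 hxc).exists_pow_eq''
      have : ∀ k : ℕ, (γ ^ k) y ∈ S ↔ y ∈ S := by
        intro k
        induction k with
        | zero => simp
        | succ k ih => rw [pow_succ', Perm.mul_apply, hS, ih]
      exact (this k).1 hx
    rw [hd.symmDiff_eq_sup, Finset.sup_eq_union, signOn_disjoint_union hS hinv hd,
      Finset.card_union_of_disjoint hd, pow_add]
    linear_combination (-1) ^ S.card * signOn S γ * signOn_cycle γ y hc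
  by_cases hS : ∀ x, γ x ∈ S ↔ x ∈ S
  · have hS' : ∀ x, γ x ∈ symmDiff S c ↔ x ∈ symmDiff S c := fun x => by
      rw [Finset.mem_symmDiff, Finset.mem_symmDiff, hS, hinv]
    -- If the cycle is contained in S, `key` is applied to S with the cycle removed.
    by_cases hy : y ∈ S
    · have := key (symmDiff S c) (by simp [Finset.mem_symmDiff, hy, hc, SameCycle.rfl]) hS'
      rw [symmDiff_symmDiff_cancel_right] at this
      rw [this, neg_neg]
    · exact key S hy hS
  · have hS' : ¬ ∀ x, γ x ∈ symmDiff S c ↔ x ∈ symmDiff S c := fun h => hS fun x => by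
      have := h x
      rw [Finset.mem_symmDiff, Finset.mem_symmDiff, hinv] at this
      tauto
    rw [signOn_of_not_invariant hS, signOn_of_not_invariant hS']
    simp

-- If γ has a cycle avoiding r, toggling that cycle cancels all terms in pairs. If not, the empty
-- set is the only invariant set without r.
open Classical in
theorem sum_signed_signOn (γ : Perm X) (r : X) :
    ∑ S : Finset X with r ∉ S, (-1) ^ S.card * signOn S γ =
      if ∀ y, SameCycle γ r y then 1 else 0 := by
  split_ifs with h
  · rw [Finset.sum_eq_single ∅]
    · simp [signOn_of_fixes]
    · intro S hS hne
      rw [signOn_of_not_invariant, mul_zero]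
      intro hinv
      refine hne (Finset.eq_empty_of_forall_notMem fun x hx => ?_)
      obtain ⟨k, -, -, hk⟩ := (h x).symm.exists_pow_eq''
      have : ∀ k : ℕ, (γ ^ k) x ∈ S := by
        intro k
        induction k with
        | zero => simpa
        | succ k ih => rwa [pow_succ', Perm.mul_apply, hinv]
      exact (Finset.mem_filter.1 hS).2 (hk ▸ this k)
    · simp
  · push Not at h
    obtain ⟨y, hy⟩ := h
    let c : Finset X := Finset.univ.filter fun x => SameCycle γ y x
    have hc : ∀ x, x ∈ c ↔ SameCycle γ y x := fun x => by simp [c]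
    have hr : r ∉ c := fun h => hy ((hc r).1 h).symm
    refine Finset.sum_involution (fun S _ => symmDiff S c) ?_ ?_ ?_ ?_
    · intro S _
      rw [signed_signOn_symmDiff_cycle γ y hc]
      ring
    · intro S _ _ h
      have : c = ∅ := by simpa using h
      exact Finset.notMem_empty y (this ▸ (hc y).2 SameCycle.rfl)
    · intro S hS
      have hS := (Finset.mem_filter.1 hS).2
      simp [Finset.mem_symmDiff, hS, hr]
    · intro S _
      exact symmDiff_symmDiff_cancel_right _ _

/-! ### Cycle sums weighted by a Young subgroup -/

/-- The sum of `sign(γ|S) x ^ numCycles (w γ)` over all `γ` that leave `S` invariant. -/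
noncomputable def youngSum (S : Finset X) (x : ℚ) (w : Perm X) : ℚ :=
  ∑ γ : Perm X, signOn S γ * x ^ numCycles (w * γ)

theorem signOn_mul_self {S : Finset X} {δ : Perm X} (hδ : ∀ x, δ x ∈ S ↔ x ∈ S) :
    signOn S δ * signOn S δ = 1 := by
  rw [signOn, dif_pos hδ]
  exact_mod_cast Int.units_coe_mul_self _

theorem youngSum_mul_right {S : Finset X} (x : ℚ) (w : Perm X) {δ : Perm X}
    (hδ : ∀ x, δ x ∈ S ↔ x ∈ S) : youngSum S x (w * δ) = signOn S δ * youngSum S x w := by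
  have h : ∀ δ' : Perm X, signOn S (δ * δ') = signOn S δ * signOn S δ' := by
    intro δ'
    by_cases h' : ∀ x, δ' x ∈ S ↔ x ∈ S
    · exact signOn_mul _ h'
    · rw [signOn_of_not_invariant h', signOn_of_not_invariant, mul_zero]
      exact fun h => h' fun x => by rw [← hδ, ← Perm.mul_apply, h]
  rw [youngSum, youngSum, Finset.mul_sum]
  refine Fintype.sum_equiv (Equiv.mulLeft δ) _ _ fun γ => ?_
  rw [Equiv.coe_mulLeft, h, ← mul_assoc, ← mul_assoc, signOn_mul_self hδ, one_mul, mul_assoc w]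

/-- Cycle numbers are invariant under cyclic rotation of a product, so δ can be moved to the right
end and absorbed into γ. -/
theorem youngSum_mul_left {S : Finset X} (x : ℚ) (w : Perm X) {δ : Perm X}
    (hδ : ∀ x, δ x ∈ S ↔ x ∈ S) : youngSum S x (δ * w) = signOn S δ * youngSum S x w := by
  rw [youngSum, youngSum, Finset.mul_sum]
  refine Fintype.sum_equiv (Equiv.mulRight δ) _ _ fun γ => ?_
  rw [Equiv.coe_mulRight, signOn_mul _ hδ, mul_assoc δ, numCycles_mul_comm δ, mul_assoc w γ δ]
  linear_combination -signOn S γ * x ^ numCycles (w * (γ * δ)) * signOn_mul_self hδ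

/-- Only γ that split as a permutation of S and one of its complement contribute; the sum factors
into a signed and an unsigned cycle sum. -/
theorem youngSum_one (S : Finset X) (x : ℚ) :
    youngSum S x 1 = (∏ i ∈ Finset.range S.card, (x - i)) *
      ∏ i ∈ Finset.range (Fintype.card X - S.card), (x + i) := by
  have h1 := sum_perm_sign_pow_mul_pow_numCycles (X := {a // a ∈ S}) 1 x
  have h2 := sum_perm_sign_pow_mul_pow_numCycles (X := {a // a ∉ S}) 0 x
  simp only [pow_one, Fintype.card_coe, pow_zero, one_mul, neg_mul, ← sub_eq_add_neg,
    Fintype.card_subtype_compl] at h1 h2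
  rw [← h1, ← h2, Fintype.sum_mul_sum, ← Fintype.sum_prod_type', youngSum]
  symm
  refine Finset.sum_of_injOn (subtypeCongrHom (· ∈ S))
    (subtypeCongrHom_injective (· ∈ S)).injOn (fun _ _ => Finset.mem_coe.2 (Finset.mem_univ _))
    ?_ ?_
  · intro γ _ hγ
    rw [signOn_of_not_invariant, zero_mul]
    intro h
    refine hγ ⟨(γ.subtypePerm h, γ.subtypePerm fun x => not_congr (h x)),
      Finset.mem_coe.2 (Finset.mem_univ _), ?_⟩
    ext y
    simp only [subtypeCongrHom_apply, subtypeCongr.apply]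
    split_ifs <;> simp
  · rintro ⟨a, b⟩ _
    have h : ∀ y, (a.subtypeCongr b) y ∈ S ↔ y ∈ S := fun y => by
      rw [subtypeCongr.apply]
      split_ifs with hy
      · simp [hy]
      · simpa [hy] using (b ⟨y, hy⟩).2
    have h' : (a.subtypeCongr b).subtypePerm h = a := by
      ext y
      simp
    simp only [subtypeCongrHom_apply, one_mul]
    rw [signOn, dif_pos h, h', numCycles_subtypeCongr, pow_add]
    ring

/-- If γ preserves S, then a and b lie on different cycles and the transposition joins them, which
costs one factor x. -/
theorem mul_youngSum_swap {S : Finset X} (x : ℚ) {a b : X} (ha : a ∈ S) (hb : b ∉ S) :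
    x * youngSum S x (swap a b) = youngSum S x 1 := by
  rw [youngSum, youngSum, Finset.mul_sum]
  refine Finset.sum_congr rfl fun γ _ => ?_
  by_cases h : ∀ y, γ y ∈ S ↔ y ∈ S
  · have hab : ¬ SameCycle γ a b := by
      intro hab
      obtain ⟨k, -, -, rfl⟩ := hab.exists_pow_eq''
      have : ∀ k : ℕ, (γ ^ k) a ∈ S := by
        intro k
        induction k with
        | zero => simpa
        | succ k ih => rwa [pow_succ', Perm.mul_apply, h]
      exact hb (this k)
    rw [one_mul, ← numCycles_swap_mul hab, pow_succ]
    ring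
  · simp [signOn_of_not_invariant h]

/-- Since w (a b) = (w a w b) w, one transposition can be absorbed on the right, inside S, with sign
-1, or on the left, outside S, with sign 1. The sum equals its own negative. -/
theorem youngSum_eq_zero {S : Finset X} (x : ℚ) {w : Perm X} {a b : X} (hab : a ≠ b)
    (ha : a ∈ S) (hb : b ∈ S) (ha' : w a ∉ S) (hb' : w b ∉ S) : youngSum S x w = 0 := by
  have h1 : ∀ y, y ∈ S → swap (w a) (w b) y = y := fun y hy =>
    swap_apply_of_ne_of_ne (fun h => ha' (h ▸ hy)) fun h => hb' (h ▸ hy)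
  have h2 : ∀ y, y ∉ S → swap a b y = y := fun y hy =>
    swap_apply_of_ne_of_ne (fun h => hy (h ▸ ha)) fun h => hy (h ▸ hb)
  have h3 := youngSum_mul_left x w (invariant_of_fixes h1)
  have h4 := youngSum_mul_right x w (invariant_of_fixes_compl h2)
  rw [mul_swap_eq_swap_mul, h3, signOn_of_fixes h1, signOn_of_fixes_compl h2, Perm.sign_swap hab] at h4
  norm_num at h4
  linarith

end SignOn

/-! ### A standard fixed-point-free involution -/

section Flip

variable {ι : Type*} [DecidableEq ι]

/-- Exchange `(i, false)` and `(i, true)` for all `i ∈ T`. -/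
def flipOn (T : Finset ι) : Perm (ι × Bool) :=
  prodCongrRight fun i => if i ∈ T then swap false true else 1

theorem flipOn_of_mem {T : Finset ι} {i : ι} (h : i ∈ T) (c : Bool) :
    flipOn T (i, c) = (i, !c) := by
  cases c <;> simp [flipOn, h]

theorem flipOn_of_notMem {T : Finset ι} {i : ι} (h : i ∉ T) (c : Bool) :
    flipOn T (i, c) = (i, c) := by
  simp [flipOn, h]

variable [Fintype ι]

theorem sign_flipOn (T : Finset ι) : sign (flipOn T) = (-1) ^ T.card := by
  rw [flipOn, sign_prodCongrRight]
  have : ∀ i, sign (if i ∈ T then swap false true else 1) = if i ∈ T then -1 else 1 := by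
    intro i
    split_ifs <;> simp
  simp [this]

theorem youngSum_flip_prod (T : Finset ι) (x : ℚ) :
    youngSum (T ×ˢ (Finset.univ : Finset Bool)) x (flipOn Finset.univ) =
      (-1) ^ T.card * youngSum (T ×ˢ (Finset.univ : Finset Bool)) x 1 := by
  have h : flipOn (Finset.univ : Finset ι) = 1 * flipOn Tᶜ * flipOn T := by
    ext1 ⟨i, c⟩
    by_cases hi : i ∈ T <;> simp [flipOn_of_mem, flipOn_of_notMem, hi]
  have h1 : ∀ y ∈ T ×ˢ (Finset.univ : Finset Bool), flipOn Tᶜ y = y := by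
    rintro ⟨i, c⟩ hi
    exact flipOn_of_notMem (by simpa using hi) c
  have h2 : ∀ y, y ∉ T ×ˢ (Finset.univ : Finset Bool) → flipOn T y = y := by
    rintro ⟨i, c⟩ hi
    exact flipOn_of_notMem (by simpa using hi) c
  rw [h, youngSum_mul_right _ _ (invariant_of_fixes_compl h2),
    youngSum_mul_right _ _ (invariant_of_fixes h1), signOn_of_fixes h1, signOn_of_fixes_compl h2,
    sign_flipOn]
  push_cast
  ring

/-- The flip factors into the edge of a, the edges outside S and the edges inside S. The last two
preserve S and are absorbed; the first is handled by `mul_youngSum_swap`. -/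
theorem mul_youngSum_flip_insert (T : Finset ι) (a : ι × Bool) (ha : a.1 ∉ T) (x : ℚ) :
    x * youngSum (insert a (T ×ˢ (Finset.univ : Finset Bool))) x (flipOn Finset.univ) =
      (-1) ^ T.card * youngSum (insert a (T ×ˢ (Finset.univ : Finset Bool))) x 1 := by
  obtain ⟨i₀, c₀⟩ := a
  have h : flipOn (Finset.univ : Finset ι) =
      swap (i₀, c₀) (i₀, !c₀) * flipOn (insert i₀ T)ᶜ * flipOn T := by
    ext1 ⟨i, c⟩
    by_cases hi : i ∈ T
    · have hne : i ≠ i₀ := fun h => ha (h ▸ hi)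
      rw [flipOn_of_mem (Finset.mem_univ i), Perm.mul_apply, Perm.mul_apply, flipOn_of_mem hi,
        flipOn_of_notMem (by simp [hi]), swap_apply_of_ne_of_ne] <;> simp [hne]
    · rw [flipOn_of_mem (Finset.mem_univ i), Perm.mul_apply, Perm.mul_apply, flipOn_of_notMem hi]
      by_cases hne : i = i₀
      · subst hne
        rw [flipOn_of_notMem (by simp)]
        by_cases hc : c = c₀
        · simp [hc]
        · have : c = !c₀ := by cases c <;> cases c₀ <;> simp_all
          rw [this, swap_apply_right]
          simp
      · rw [flipOn_of_mem (by simp [hi, hne]), swap_apply_of_ne_of_ne] <;> simp [hne]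
  have h1 : ∀ y ∈ insert (i₀, c₀) (T ×ˢ (Finset.univ : Finset Bool)),
      flipOn (insert i₀ T)ᶜ y = y := by
    rintro ⟨i, c⟩ hi
    refine flipOn_of_notMem ?_ c
    simp only [Finset.mem_insert, Prod.mk.injEq, Finset.mem_product, Finset.mem_univ,
      and_true] at hi
    simp only [Finset.mem_compl, Finset.mem_insert, not_not]
    tauto
  have h2 : ∀ y, y ∉ insert (i₀, c₀) (T ×ˢ (Finset.univ : Finset Bool)) → flipOn T y = y := by
    rintro ⟨i, c⟩ hi
    refine flipOn_of_notMem ?_ c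
    simp only [Finset.mem_insert, Prod.mk.injEq, Finset.mem_product, Finset.mem_univ,
      and_true] at hi
    tauto
  rw [h, youngSum_mul_right _ _ (invariant_of_fixes_compl h2),
    youngSum_mul_right _ _ (invariant_of_fixes h1), signOn_of_fixes h1, signOn_of_fixes_compl h2,
    sign_flipOn, ← mul_youngSum_swap (a := (i₀, c₀)) (b := (i₀, !c₀)) x (by simp)
      (by simpa using ha)]
  push_cast
  ring

/-- A set S on which g need not vanish has at most one element whose partner is missing: it is a
union of whole edges, possibly with one extra half-edge a. -/
theorem sum_finset_prod_bool (g : Finset (ι × Bool) → ℚ)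
    (hg : ∀ S a b, a ≠ b → a ∈ S → b ∈ S → (a.1, !a.2) ∉ S → (b.1, !b.2) ∉ S → g S = 0) :
    ∑ S, g S = ∑ T : Finset ι, g (T ×ˢ Finset.univ) +
      ∑ a : ι × Bool, ∑ T ∈ (Finset.univ.erase a.1).powerset,
        g (insert a (T ×ˢ Finset.univ)) := by
  classical
  let f : Finset ι → Finset (ι × Bool) := fun T => T ×ˢ Finset.univ
  let f' : (Σ _ : ι × Bool, Finset ι) → Finset (ι × Bool) :=
    fun p => insert p.1 (p.2 ×ˢ Finset.univ)
  let D : Finset (Σ _ : ι × Bool, Finset ι) :=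
    Finset.univ.sigma fun a => (Finset.univ.erase a.1).powerset
  have hD : ∀ p ∈ D, p.1.1 ∉ p.2 := by
    intro p hp h
    simp only [D, Finset.mem_sigma, Finset.mem_powerset] at hp
    simpa using hp.2 h
  have hf : Function.Injective f := by
    intro T T' h
    ext i
    have := Finset.ext_iff.1 h (i, true)
    simpa [f] using this
  have hleave : ∀ p ∈ D, ∀ a, a ∈ f' p → (a.1, !a.2) ∉ f' p → a = p.1 := by
    rintro ⟨b, T⟩ hp ⟨i, c⟩ h1 h2
    simp only [f', Finset.mem_insert, Finset.mem_product, Finset.mem_univ, and_true] at h1 h2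
    tauto
  have hleave' : ∀ p ∈ D, (p.1.1, !p.1.2) ∉ f' p := by
    rintro ⟨⟨i, c⟩, T⟩ hp
    have := hD _ hp
    simpa [f'] using this
  have hf' : Set.InjOn f' D := by
    rintro p hp q hq h
    have h1 : p.1 = q.1 := hleave q hq p.1 (h ▸ Finset.mem_insert_self _ _) (h ▸ hleave' p hp)
    obtain ⟨⟨i, c⟩, T⟩ := p
    obtain ⟨b, T'⟩ := q
    obtain rfl : (i, c) = b := h1
    congr 1
    ext j
    have h2 := hD _ hp
    have h3 := hD _ hq
    have := Finset.ext_iff.1 h (j, !c)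
    simpa [f'] using this
  have hdisj : Disjoint (Finset.univ.image f) (D.image f') := by
    rw [Finset.disjoint_left]
    rintro S hS hS'
    obtain ⟨T, -, rfl⟩ := Finset.mem_image.1 hS
    obtain ⟨p, hp, h⟩ := Finset.mem_image.1 hS'
    have h1 : p.1 ∈ f T := h ▸ Finset.mem_insert_self _ _
    have h2 := hleave' p hp
    rw [h] at h2
    simp only [f, Finset.mem_product, Finset.mem_univ, and_true] at h1 h2
    exact h2 h1
  have hsig : ∑ a : ι × Bool, ∑ T ∈ (Finset.univ.erase a.1).powerset,
      g (insert a (T ×ˢ Finset.univ)) = ∑ p ∈ D, g (f' p) :=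
    Finset.sum_sigma' _ _ fun a T => g (f' ⟨a, T⟩)
  rw [hsig, ← Finset.sum_image (f := g) (g := f) (fun _ _ _ _ h => hf h),
    ← Finset.sum_image (f := g) (g := f') hf', ← Finset.sum_union hdisj]
  symm
  refine Finset.sum_subset (Finset.subset_univ _) fun S _ hS => ?_
  rw [Finset.mem_union, not_or] at hS
  by_cases h : ∃ a, a ∈ S ∧ (a.1, !a.2) ∉ S
  · obtain ⟨a, ha, ha'⟩ := h
    by_cases h' : ∃ b, a ≠ b ∧ b ∈ S ∧ (b.1, !b.2) ∉ S
    · obtain ⟨b, hab, hb, hb'⟩ := h'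
      exact hg S a b hab ha hb ha' hb'
    · push Not at h'
      refine (hS.2 (Finset.mem_image.2
        ⟨⟨a, Finset.univ.filter fun i => (i, true) ∈ S ∧ (i, false) ∈ S⟩, ?_, ?_⟩)).elim
      · simp only [D, Finset.mem_sigma, Finset.mem_univ, Finset.mem_powerset, true_and]
        intro i hi
        refine Finset.mem_erase.2 ⟨?_, Finset.mem_univ _⟩
        rintro rfl
        rcases a with ⟨i, _ | _⟩ <;> simp_all
      · ext ⟨i, c⟩
        simp only [f', Finset.mem_insert, Finset.mem_product, Finset.mem_filter, Finset.mem_univ,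
          true_and, and_true]
        constructor
        · rintro (rfl | h)
          · exact ha
          · cases c
            exacts [h.2, h.1]
        · intro hic
          by_cases h : a = (i, c)
          · exact Or.inl h.symm
          · have := h' (i, c) h hic
            right
            cases c <;> simp_all
  · push Not at h
    refine (hS.1 (Finset.mem_image.2
      ⟨Finset.univ.filter fun i => (i, true) ∈ S, Finset.mem_univ _, ?_⟩)).elim
    ext ⟨i, c⟩
    simp only [f, Finset.mem_product, Finset.mem_filter, Finset.mem_univ, true_and, and_true]
    cases c
    · exact ⟨fun h' => by simpa using h _ h', fun h' => by simpa using h _ h'⟩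
    · rfl

/-! ### Sums over long cycles -/

open Classical in
/-- The sum of `x ^ numCycles (w γ)` over all permutations `γ` with one cycle only. -/
noncomputable def longCycleSum {X : Type*} [Fintype X] (x : ℚ) (w : Perm X) : ℚ :=
  ∑ γ : Perm X with ∀ a b, SameCycle γ a b, x ^ numCycles (w * γ)

theorem longCycleSum_eq_sum_youngSum {X : Type*} [Fintype X] [DecidableEq X] (x : ℚ) (w : Perm X)
    (r : X) :
    longCycleSum x w = ∑ S : Finset X with r ∉ S, (-1) ^ S.card * youngSum S x w := by
  simp only [youngSum, Finset.mul_sum, ← mul_assoc]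
  rw [Finset.sum_comm]
  simp only [← Finset.sum_mul, sum_signed_signOn]
  rw [longCycleSum, Finset.sum_filter]
  refine Finset.sum_congr (by congr!) fun γ _ => ?_
  have : (∀ a b, SameCycle γ a b) ↔ ∀ b, SameCycle γ r b :=
    ⟨fun h => h r, fun h a b => (h a).symm.trans (h b)⟩
  simp [this]

/-- Averaging over the base point r replaces the condition that S avoids r by a weight depending
only on the size of S. -/
theorem card_mul_longCycleSum {X : Type*} [Fintype X] [DecidableEq X] (x : ℚ) (w : Perm X) :
    (Fintype.card X : ℚ) * longCycleSum x w =
      ∑ S : Finset X, ((Fintype.card X : ℚ) - S.card) * ((-1) ^ S.card * youngSum S x w) := by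
  have h : ∑ _r : X, longCycleSum x w =
      ∑ r : X, ∑ S : Finset X with r ∉ S, (-1) ^ S.card * youngSum S x w :=
    Finset.sum_congr rfl fun r _ => longCycleSum_eq_sum_youngSum x w r
  rw [Finset.sum_const, Finset.card_univ, nsmul_eq_mul] at h
  rw [h]
  simp only [Finset.sum_filter]
  rw [Finset.sum_comm]
  refine Finset.sum_congr rfl fun S _ => ?_
  rw [← Finset.sum_filter, Finset.sum_const, nsmul_eq_mul]
  congr 1
  have : (Finset.univ.filter fun r => r ∉ S) = Sᶜ := by
    ext
    simp
  rw [this, Finset.card_compl, Nat.cast_sub (Finset.card_le_univ S)]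

/-- The product of a falling factorial of length `k` and a rising factorial of length `m - k`. -/
def fallingRising (m k : ℕ) (x : ℚ) : ℚ :=
  (∏ i ∈ Finset.range k, (x - i)) * ∏ i ∈ Finset.range (m - k), (x + i)

/-- The two terms of the summand come from the two kinds of surviving S. The factor x on the left is
the one required by `mul_youngSum_flip_insert`. -/
theorem mul_longCycleSum_flip (n : ℕ) (hn : Fintype.card ι = n + 1) (x : ℚ) :
    x * longCycleSum x (flipOn (Finset.univ : Finset ι)) =
      ∑ j ∈ Finset.range (n + 1), (-1) ^ j * (n.choose j : ℚ) *
        (x * fallingRising (2 * n + 2) (2 * j) x -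
          (2 * n + 1 - 2 * j) * fallingRising (2 * n + 2) (2 * j + 1) x) := by
  have hX : Fintype.card (ι × Bool) = 2 * n + 2 := by
    rw [Fintype.card_prod, hn, Fintype.card_bool]
    ring
  have h := card_mul_longCycleSum x (flipOn (Finset.univ : Finset ι))
  rw [sum_finset_prod_bool _ ?_] at h
  swap
  · rintro S ⟨i, c⟩ ⟨i', c'⟩ hab ha hb ha' hb'
    rw [youngSum_eq_zero x hab ha hb (by rwa [flipOn_of_mem (Finset.mem_univ _)])
      (by rwa [flipOn_of_mem (Finset.mem_univ _)])]
    ring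
  have h1 : x * ∑ T : Finset ι, (((Fintype.card (ι × Bool) : ℕ) : ℚ) -
      ((T ×ˢ (Finset.univ : Finset Bool)).card : ℕ)) *
        ((-1) ^ (T ×ˢ (Finset.univ : Finset Bool)).card *
          youngSum (T ×ˢ (Finset.univ : Finset Bool)) x (flipOn Finset.univ)) =
      (2 * n + 2) * ∑ j ∈ Finset.range (n + 1), (-1) ^ j * (n.choose j : ℚ) *
        (x * fallingRising (2 * n + 2) (2 * j) x) := by
    obtain ⟨F, hF⟩ : ∃ F : ℕ → ℚ, ∀ j, F j =
        (2 * n + 2 - 2 * j) * ((-1) ^ j * fallingRising (2 * n + 2) (2 * j) x) := ⟨_, fun _ => rfl⟩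
    have e1 : ∀ T : Finset ι, (((Fintype.card (ι × Bool) : ℕ) : ℚ) -
      ((T ×ˢ (Finset.univ : Finset Bool)).card : ℕ)) *
        ((-1) ^ (T ×ˢ (Finset.univ : Finset Bool)).card *
          youngSum (T ×ˢ (Finset.univ : Finset Bool)) x (flipOn Finset.univ)) =
        F T.card := by
      intro T
      have hc : (T ×ˢ (Finset.univ : Finset Bool)).card = 2 * T.card := by
        rw [Finset.card_product, Finset.card_univ, Fintype.card_bool, mul_comm]
      rw [hF, youngSum_flip_prod, youngSum_one, hc, hX, fallingRising, pow_mul]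
      push_cast
      ring
    rw [Finset.sum_congr rfl fun T _ => e1 T, ← Finset.powerset_univ,
      Finset.sum_powerset_apply_card, Finset.card_univ, hn, Finset.sum_range_succ, Finset.mul_sum]
    -- The full set of half-edges avoids no base point, so its weight is zero.
    have e2 : F (n + 1) = 0 := by
      rw [hF]
      push_cast
      ring
    rw [e2, smul_zero, add_zero, Finset.mul_sum]
    refine Finset.sum_congr rfl fun j hj => ?_
    have hj : j ≤ n + 1 := (Finset.mem_range.1 hj).le
    -- Turns the number of j-sets of the n + 1 edges, times the averaging weight, into a multiple of
    -- the binomial coefficient for n.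
    have e3 : (n.choose j : ℚ) * (n + 1) = ((n + 1).choose j : ℚ) * (n + 1 - j) := by
      have := Nat.choose_mul_succ_eq n j
      rw [← @Nat.cast_inj ℚ] at this
      push_cast [Nat.cast_sub hj] at this
      exact this
    rw [nsmul_eq_mul, hF]
    linear_combination (-2 * (-1) ^ j * x * fallingRising (2 * n + 2) (2 * j) x) * e3
  have h2 : x * ∑ a : ι × Bool, ∑ T ∈ (Finset.univ.erase a.1).powerset,
      (((Fintype.card (ι × Bool) : ℕ) : ℚ) -
        ((insert a (T ×ˢ (Finset.univ : Finset Bool))).card : ℕ)) *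
          ((-1) ^ (insert a (T ×ˢ (Finset.univ : Finset Bool))).card *
            youngSum (insert a (T ×ˢ (Finset.univ : Finset Bool))) x (flipOn Finset.univ)) =
      -((2 * n + 2) * ∑ j ∈ Finset.range (n + 1), (-1) ^ j * (n.choose j : ℚ) *
        ((2 * n + 1 - 2 * j) * fallingRising (2 * n + 2) (2 * j + 1) x)) := by
    obtain ⟨F, hF⟩ : ∃ F : ℕ → ℚ, ∀ j, F j = -((2 * n + 1 - 2 * j) *
        ((-1) ^ j * fallingRising (2 * n + 2) (2 * j + 1) x)) := ⟨_, fun _ => rfl⟩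
    have e1 : ∀ a : ι × Bool, ∀ T ∈ (Finset.univ.erase a.1).powerset,
      x * ((((Fintype.card (ι × Bool) : ℕ) : ℚ) -
        ((insert a (T ×ˢ (Finset.univ : Finset Bool))).card : ℕ)) *
          ((-1) ^ (insert a (T ×ˢ (Finset.univ : Finset Bool))).card *
            youngSum (insert a (T ×ˢ (Finset.univ : Finset Bool))) x (flipOn Finset.univ))) =
        F T.card := by
      intro a T hT
      have ha : a.1 ∉ T := fun h => by simpa using Finset.mem_powerset.1 hT h
      have hc : (insert a (T ×ˢ (Finset.univ : Finset Bool))).card = 2 * T.card + 1 := by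
        rw [Finset.card_insert_of_notMem (by simpa using ha), Finset.card_product,
          Finset.card_univ, Fintype.card_bool, mul_comm]
      have hy := mul_youngSum_flip_insert T a ha x
      rw [youngSum_one, hc, hX] at hy
      rw [hF, hc, hX, fallingRising, pow_succ, pow_mul]
      push_cast at hy ⊢
      simp only [even_two, Even.neg_pow, one_pow, one_mul]
      linear_combination -(2 * n + 2 - (2 * T.card + 1) : ℚ) * hy
    rw [Finset.mul_sum]
    have e2 : ∀ a : ι × Bool, x * ∑ T ∈ (Finset.univ.erase a.1).powerset,
      (((Fintype.card (ι × Bool) : ℕ) : ℚ) -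
        ((insert a (T ×ˢ (Finset.univ : Finset Bool))).card : ℕ)) *
          ((-1) ^ (insert a (T ×ˢ (Finset.univ : Finset Bool))).card *
            youngSum (insert a (T ×ˢ (Finset.univ : Finset Bool))) x (flipOn Finset.univ)) =
        -∑ j ∈ Finset.range (n + 1), (-1) ^ j * (n.choose j : ℚ) *
          ((2 * n + 1 - 2 * j) * fallingRising (2 * n + 2) (2 * j + 1) x) := by
      intro a
      rw [Finset.mul_sum, Finset.sum_congr rfl (e1 a), Finset.sum_powerset_apply_card,
        Finset.card_erase_of_mem (Finset.mem_univ _), Finset.card_univ, hn, Nat.add_sub_cancel,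
        ← Finset.sum_neg_distrib]
      refine Finset.sum_congr rfl fun j _ => ?_
      rw [nsmul_eq_mul, hF]
      ring
    rw [Finset.sum_congr rfl fun a _ => e2 a, Finset.sum_const, Finset.card_univ, hX,
      nsmul_eq_mul]
    push_cast
    ring
  have h3 : (2 * n + 2 : ℚ) ≠ 0 := by positivity
  refine mul_left_cancel₀ h3 ?_
  simp only [mul_sub, Finset.sum_sub_distrib]
  have hX' : ((Fintype.card (ι × Bool) : ℕ) : ℚ) = 2 * n + 2 := by
    rw [hX]
    push_cast
    ring
  rw [sub_eq_add_neg, ← h1, ← h2, ← mul_add, ← h, hX']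
  ring

end Flip

/-! ### Evaluation by power series -/

/-- The factors are the k + q consecutive numbers from N - k + 1 to N + q, with N occurring once
more. -/
theorem prod_sub_mul_prod_add_eq_choose (N k q : ℕ) :
    (∏ i ∈ Finset.range k, ((N : ℚ) - i)) * ∏ i ∈ Finset.range (q + 1), ((N : ℚ) + i) =
      N * (k + q).factorial * (N + q).choose (k + q) := by
  induction q with
  | zero =>
    have h : ∏ i ∈ Finset.range k, ((N : ℚ) - i) = (N.descFactorial k : ℚ) := by
      induction k with
      | zero => simp
      | succ k ih =>
        rw [Finset.prod_range_succ, ih, Nat.descFactorial_succ]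
        rcases le_or_gt k N with h | h
        · push_cast [Nat.cast_sub h]
          ring
        · rw [Nat.descFactorial_of_lt h]
          simp
    rw [h, Nat.descFactorial_eq_factorial_mul_choose]
    simp
    ring
  | succ q ih =>
    have h : ((N + q : ℕ) + 1 : ℚ) * (N + q).choose (k + q) =
        (N + q + 1).choose (k + q + 1) * ((k + q : ℕ) + 1) := by
      exact_mod_cast Nat.add_one_mul_choose_eq (N + q) (k + q)
    rw [Finset.prod_range_succ, ← mul_assoc, ih, ← add_assoc, ← add_assoc, Nat.factorial_succ]
    push_cast at h ⊢
    linear_combination (N * (k + q).factorial : ℚ) * h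

open PowerSeries in
theorem coeff_X_pow_mul_geom_pow (N k q : ℕ) :
    coeff N ((X : ℚ⟦X⟧) ^ k * (mk 1) ^ (k + q + 1)) = ((N + q).choose (k + q) : ℚ) := by
  rw [coeff_X_pow_mul', mk_one_pow_eq_mk_choose_add, coeff_mk]
  split_ifs with h
  · congr 2
    omega
  · rw [Nat.choose_eq_zero_of_lt (by omega), Nat.cast_zero]

open PowerSeries in
theorem coeff_X_mul_derivative (N : ℕ) (f : ℚ⟦X⟧) :
    coeff N (X * derivative ℚ f) = N * coeff N f := by
  cases N with
  | zero => simp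
  | succ N =>
    rw [coeff_succ_X_mul, coeff_derivative]
    push_cast
    ring

open PowerSeries in
theorem derivative_geom : derivative ℚ (mk 1 : ℚ⟦X⟧) = (mk 1) ^ 2 := by
  have h : (1 - X : ℚ⟦X⟧) * mk 1 = 1 := by
    rw [mul_comm]
    exact mk_one_mul_one_sub_eq_one ℚ
  have h' := congrArg (derivative ℚ) h
  simp only [Derivation.leibniz, map_sub, Derivation.map_one_eq_zero, derivative_X,
    smul_eq_mul] at h'
  linear_combination (mk 1) * h' - derivative ℚ (mk 1 : ℚ⟦X⟧) * h

open PowerSeries in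
-- Here `mk 1` is 1 / (1 - X). After cancelling powers of 1 - X, the bracket n (1 - X) + (n + 2) (1
-- + X) - (2n + 1) + X^2 remains, which is (1 + X)^2.
theorem alternating_geom_identity (n : ℕ) :
    X * derivative ℚ ((1 - X ^ 2 : ℚ⟦X⟧) ^ n * (mk 1) ^ (2 * n + 2)) -
      X * ((2 * (n : ℚ⟦X⟧) + 1) * (1 - X ^ 2) ^ n - X * derivative ℚ ((1 - X ^ 2 : ℚ⟦X⟧) ^ n)) *
        (mk 1) ^ (2 * n + 2) = X * (1 + X) ^ (n + 1) * (mk 1) ^ (n + 3) := by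
  have h : (1 - X : ℚ⟦X⟧) * mk 1 = 1 := by
    rw [mul_comm]
    exact mk_one_mul_one_sub_eq_one ℚ
  have hX : derivative ℚ (1 - X ^ 2 : ℚ⟦X⟧) = -2 * X := by
    simp [Derivation.leibniz_pow]
  rw [Derivation.leibniz, Derivation.leibniz_pow, Derivation.leibniz_pow, derivative_geom, hX]
  simp only [smul_eq_mul, nsmul_eq_mul]
  generalize (mk 1 : ℚ⟦X⟧) = V at h
  -- The derivative of an n-th power contains the exponent n - 1, so n = 0 is separate. Afterwards
  -- the n-th powers become atoms linked only by `hn` and `h`.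
  rcases n with _ | n
  · simp only [Nat.cast_zero, mul_zero, zero_mul, add_zero, zero_add, sub_zero]
    push_cast
    linear_combination (X * V ^ 2) * h
  · have e1 : (1 - X ^ 2 : ℚ⟦X⟧) ^ n = (1 - X) ^ n * (1 + X) ^ n := by
      rw [← mul_pow]
      ring
    have hn : (1 - X : ℚ⟦X⟧) ^ n * V ^ n = 1 := by rw [← mul_pow, h, one_pow]
    have e2 : V ^ (2 * (n + 1) + 2) = (V ^ n) ^ 2 * V ^ 4 := by ring
    have e3 : V ^ (2 * (n + 1) + 2 - 1) = (V ^ n) ^ 2 * V ^ 3 := by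
      rw [show 2 * (n + 1) + 2 - 1 = 2 * n + 3 by omega]
      ring
    rw [Nat.add_sub_cancel, e2, e3, pow_succ (1 - X ^ 2 : ℚ⟦X⟧), e1,
      show V ^ (n + 1 + 3) = V ^ n * V ^ 4 by ring,
      show (1 + X : ℚ⟦X⟧) ^ (n + 1 + 1) = (1 + X) ^ n * (1 + X) ^ 2 by ring]
    generalize (1 - X : ℚ⟦X⟧) ^ n = c at *
    generalize V ^ n = b at *
    generalize (1 + X : ℚ⟦X⟧) ^ n = a at *
    push_cast
    linear_combination (a * b * X * V ^ 4 * ((1 - X ^ 2) * (2 * n + 4) * V - 2 * X * (n + 1) -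
      (2 * n + 3) * (1 - X ^ 2) - 2 * (n + 1) * X ^ 2)) * hn +
      (a * b * X * V ^ 4 * (2 * n + 4) * (1 + X)) * h

-- Both sides are the same multiple of the N-th coefficients of the two sides of
-- `alternating_geom_identity`. The operator X d/dX produces the factor N, and also the weight 2n +
-- 1 - 2j.
open PowerSeries in
theorem sum_fallingRising_eq (n N : ℕ) :
    ((n + 2).factorial : ℚ) * ∑ j ∈ Finset.range (n + 1), (-1) ^ j * (n.choose j : ℚ) *
        (N * fallingRising (2 * n + 2) (2 * j) N -
          (2 * n + 1 - 2 * j) * fallingRising (2 * n + 2) (2 * j + 1) N) =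
      ((2 * n + 1).factorial : ℚ) * ∑ k ∈ Finset.range (n + 2), ((n + 1).choose k : ℚ) *
        ((∏ i ∈ Finset.range (n + 1 - k + 1), ((N : ℚ) + i)) *
          ∏ i ∈ Finset.range (k + 1), ((N : ℚ) - i)) := by
  set V : ℚ⟦X⟧ := mk 1 with hV
  have hU : (1 - X ^ 2 : ℚ⟦X⟧) ^ n =
      ∑ j ∈ Finset.range (n + 1), C ((-1) ^ j * (n.choose j : ℚ)) * X ^ (2 * j) := by
    rw [sub_eq_neg_add, add_pow]
    refine Finset.sum_congr rfl fun j _ => ?_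
    rw [one_pow, neg_pow, ← pow_mul]
    simp
    ring
  have hDU : (2 * (n : ℚ⟦X⟧) + 1) * (1 - X ^ 2 : ℚ⟦X⟧) ^ n - X * derivative ℚ ((1 - X ^ 2 : ℚ⟦X⟧) ^ n) =
      ∑ j ∈ Finset.range (n + 1),
        C ((-1) ^ j * (n.choose j : ℚ) * (2 * n + 1 - 2 * j)) * X ^ (2 * j) := by
    ext d
    have : (2 * (n : ℚ⟦X⟧) + 1) = C (2 * n + 1 : ℚ) := by
      rw [map_add, map_mul, map_natCast, map_ofNat, map_one]
    rw [map_sub, coeff_X_mul_derivative, this, coeff_C_mul, hU, map_sum, map_sum,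
      Finset.mul_sum, Finset.mul_sum, ← Finset.sum_sub_distrib]
    refine Finset.sum_congr rfl fun j _ => ?_
    rw [coeff_C_mul, coeff_C_mul, coeff_X_pow]
    split_ifs with h
    · rw [h]
      push_cast
      ring
    · ring
  have hR : X * (1 + X : ℚ⟦X⟧) ^ (n + 1) =
      ∑ k ∈ Finset.range (n + 2), C ((n + 1).choose k : ℚ) * X ^ (k + 1) := by
    rw [add_comm 1 X, add_pow, Finset.mul_sum]
    refine Finset.sum_congr rfl fun j _ => ?_
    simp
    ring
  have key := congrArg (coeff N) (alternating_geom_identity n)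
  rw [← hV, map_sub, coeff_X_mul_derivative, hDU, hR, hU, Finset.mul_sum, Finset.sum_mul,
    Finset.sum_mul, Finset.sum_mul, map_sum, map_sum, map_sum, Finset.mul_sum,
    ← Finset.sum_sub_distrib] at key
  have hL : ∀ j ∈ Finset.range (n + 1), (-1) ^ j * (n.choose j : ℚ) *
        (N * fallingRising (2 * n + 2) (2 * j) N -
          (2 * n + 1 - 2 * j) * fallingRising (2 * n + 2) (2 * j + 1) N) =
      N * (2 * n + 1).factorial * (N * coeff N (C ((-1) ^ j * (n.choose j : ℚ)) * X ^ (2 * j) *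
        V ^ (2 * n + 2)) - coeff N (X * (C ((-1) ^ j * (n.choose j : ℚ) * (2 * n + 1 - 2 * j)) *
          X ^ (2 * j)) * V ^ (2 * n + 2))) := by
    intro j hj
    have hj : j ≤ n := Nat.lt_succ_iff.1 (Finset.mem_range.1 hj)
    obtain ⟨q, rfl⟩ := Nat.exists_eq_add_of_le hj
    have h1 := prod_sub_mul_prod_add_eq_choose N (2 * j) (2 * q + 1)
    have h2 := prod_sub_mul_prod_add_eq_choose N (2 * j + 1) (2 * q)
    rw [← coeff_X_pow_mul_geom_pow, ← hV] at h1 h2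
    rw [fallingRising, fallingRising,
      show 2 * (j + q) + 2 - 2 * j = 2 * q + 1 + 1 by omega,
      show 2 * (j + q) + 2 - (2 * j + 1) = 2 * q + 1 by omega, h1, h2, mul_assoc (C _),
      coeff_C_mul, mul_left_comm X, mul_assoc (C _), coeff_C_mul, ← pow_succ',
      show 2 * j + (2 * q + 1) = 2 * (j + q) + 1 by ring,
      show 2 * j + 1 + 2 * q = 2 * (j + q) + 1 by ring]
    ring
  have hR' : ∀ k ∈ Finset.range (n + 2), ((n + 1).choose k : ℚ) *
        ((∏ i ∈ Finset.range (n + 1 - k + 1), ((N : ℚ) + i)) *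
          ∏ i ∈ Finset.range (k + 1), ((N : ℚ) - i)) =
      N * (n + 2).factorial *
        coeff N (C ((n + 1).choose k : ℚ) * X ^ (k + 1) * V ^ (n + 3)) := by
    intro k hk
    have hk : k ≤ n + 1 := Nat.lt_succ_iff.1 (Finset.mem_range.1 hk)
    have h1 := prod_sub_mul_prod_add_eq_choose N (k + 1) (n + 1 - k)
    rw [← coeff_X_pow_mul_geom_pow, ← hV, show k + 1 + (n + 1 - k) = n + 2 by omega] at h1
    rw [mul_comm (∏ i ∈ Finset.range (n + 1 - k + 1), ((N : ℚ) + i)), h1, mul_assoc (C _),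
      coeff_C_mul]
    ring
  rw [Finset.sum_congr rfl hL, Finset.sum_congr rfl hR', ← Finset.mul_sum, ← Finset.mul_sum, key]
  ring

/-! ### Generating polynomials for cycle numbers -/

open Polynomial in
/-- The generating polynomial of `permCount m`. -/
noncomputable def risingPoly (m : ℕ) : ℚ[X] := ∏ i ∈ Finset.range m, (X + C (i : ℚ))

open Polynomial in
/-- The signed analogue of `risingPoly m`. -/
noncomputable def fallingPoly (m : ℕ) : ℚ[X] := ∏ i ∈ Finset.range m, (X - C (i : ℚ))

open Polynomial in
theorem coeff_sum_X_pow {A : Type*} [Fintype A] (f : A → ℕ) (k : ℕ) :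
    (∑ a, (X : ℚ[X]) ^ f a).coeff k = Nat.card {a // f a = k} := by
  classical
  rw [finsetSum_coeff]
  simp only [coeff_X_pow]
  rw [Nat.card_eq_fintype_card, Fintype.card_subtype, Finset.sum_boole]
  simp only [eq_comm]

open Polynomial in
theorem coeff_risingPoly (m i : ℕ) : (risingPoly m).coeff i = permCount m i := by
  have h : risingPoly m = ∑ σ : Perm (Fin m), X ^ numCycles σ := by
    refine Polynomial.funext fun x => ?_
    have := sum_perm_fin_sign_pow_mul_pow_numCycles m 0 x
    simp only [pow_zero, one_mul] at this
    simp [risingPoly, eval_finsetSum, eval_prod, this]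
  rw [h, coeff_sum_X_pow]
  rfl

open Polynomial in
theorem coeff_fallingPoly (m j : ℕ) :
    (fallingPoly m).coeff j = (-1) ^ ((m : ℤ) - j) * permCount m j := by
  -- The sign (-1)^(m-j) comes from substituting -X into the rising factorial.
  have h : fallingPoly m = C ((-1) ^ m) * (risingPoly m).comp (C (-1) * X) := by
    refine Polynomial.funext fun x => ?_
    have : ((-1 : ℚ)) ^ m = ∏ i ∈ Finset.range m, (-1) := by simp
    simp only [fallingPoly, risingPoly, eval_mul, eval_comp, eval_prod, eval_C, eval_add, eval_sub,
      eval_X]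
    rw [this, ← Finset.prod_mul_distrib]
    exact Finset.prod_congr rfl fun i _ => by ring
  rw [h, coeff_C_mul, comp_C_mul_X_coeff, coeff_risingPoly, mul_comm (permCount m j : ℚ), ← mul_assoc, zpow_sub₀ (by norm_num),
    zpow_natCast, zpow_natCast]
  congr 1
  rcases neg_one_pow_eq_or ℚ j with h | h <;> rw [h] <;> simp [div_neg]

/-- The polynomial whose coefficients are the numbers `barA n g`. -/
noncomputable def barPoly (n : ℕ) : Polynomial ℚ :=
  ∑ k ∈ Finset.range (n + 1),
    Polynomial.C (n.choose k : ℚ) * (risingPoly (n - k + 1) * fallingPoly (k + 1))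

theorem barA_eq_coeff {n g d : ℕ} (h : d + 2 * g = n + 2) : barA n g = (barPoly n).coeff d := by
  rw [barA, barPoly, Polynomial.finsetSum_coeff]
  refine Finset.sum_congr rfl fun k _ => ?_
  rw [Polynomial.coeff_C_mul, Polynomial.coeff_mul]
  congr 1
  refine Finset.sum_congr ?_ fun p _ => ?_
  -- Both indices are at most d ≤ n + 2, so the ranges in `barA` cut nothing off.
  · ext ⟨i, j⟩
    simp only [Finset.mem_filter, Finset.mem_product, Finset.mem_range,
      Finset.HasAntidiagonal.mem_antidiagonal]
    omega
  · rw [coeff_risingPoly, coeff_fallingPoly]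
    push_cast
    ring

theorem barA_eq_zero {n g : ℕ} (h : n + 2 < 2 * g) : barA n g = 0 := by
  rw [barA]
  refine Finset.sum_eq_zero fun k _ => ?_
  rw [Finset.sum_eq_zero, mul_zero]
  intro p hp
  have := (Finset.mem_filter.1 hp).2
  omega

theorem eval_barPoly (n N : ℕ) : (barPoly n).eval (N : ℚ) =
    ∑ k ∈ Finset.range (n + 1), (n.choose k : ℚ) *
      ((∏ i ∈ Finset.range (n - k + 1), ((N : ℚ) + i)) *
        ∏ i ∈ Finset.range (k + 1), ((N : ℚ) - i)) := by
  simp [barPoly, risingPoly, fallingPoly, Polynomial.eval_finsetSum, Polynomial.eval_prod]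

/-! ### Fixed-point-free involutions -/

theorem cycleType_eq_replicate_two_iff {X : Type*} [Fintype X] [DecidableEq X] {n : ℕ}
    (hX : Fintype.card X = 2 * n) (α : Perm X) :
    α.cycleType = Multiset.replicate n 2 ↔ (∀ x, α (α x) = x) ∧ ∀ x, α x ≠ x := by
  constructor
  · intro h
    have h1 : α.support = Finset.univ := by
      rw [← Finset.card_eq_iff_eq_univ, ← sum_cycleType, h, hX, Multiset.sum_replicate,
        smul_eq_mul, mul_comm]
    have h2 : α ^ 2 = 1 := by
      rw [← orderOf_dvd_iff_pow_eq_one, ← lcm_cycleType, h]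
      exact Multiset.lcm_dvd.2 fun a ha => (Multiset.eq_of_mem_replicate ha).dvd
    refine ⟨fun x => ?_, fun x => ?_⟩
    · have := congrArg (fun σ : Perm X => σ x) h2
      simpa [pow_two] using this
    · rw [← mem_support, h1]
      exact Finset.mem_univ x
  · rintro ⟨h1, h2⟩
    have h3 : α ^ 2 = 1 := by
      ext x
      simp [pow_two, h1]
    have h4 := cycleType_of_pow_prime_eq_one (p := 2) h3
    have h5 := sum_cycleType α
    have h6 : α.support = Finset.univ := by
      ext x
      simp [h2]
    rw [h6, Finset.card_univ, hX, h4, Multiset.sum_replicate, smul_eq_mul] at h5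
    rw [h4]
    congr 1
    omega

theorem card_fixedPointFree_involutions {X : Type*} [Fintype X] [DecidableEq X] {n : ℕ}
    (hX : Fintype.card X = 2 * n) :
    (Finset.univ.filter fun α : Perm X => (∀ x, α (α x) = x) ∧ ∀ x, α x ≠ x).card *
      (2 ^ n * n.factorial) = (2 * n).factorial := by
  have h := card_of_cycleType_mul_eq X (Multiset.replicate n 2)
  rw [if_pos] at h
  swap
  · refine ⟨?_, fun a ha => (Multiset.eq_of_mem_replicate ha).ge⟩
    rw [hX, Multiset.sum_replicate, smul_eq_mul, mul_comm]
  have h1 : ∏ k ∈ (Multiset.replicate n 2).toFinset,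
      (Multiset.count k (Multiset.replicate n 2)).factorial = n.factorial := by
    rcases Nat.eq_zero_or_pos n with rfl | hn
    · simp
    · rw [Multiset.toFinset_replicate, if_neg hn.ne']
      simp
  rw [h1, hX, Multiset.sum_replicate, Multiset.prod_replicate, smul_eq_mul, mul_comm n 2,
    Nat.sub_self, Nat.factorial_zero, one_mul] at h
  rw [← h]
  congr 2
  ext α
  simp only [Finset.mem_filter, Finset.mem_univ, true_and]
  exact (cycleType_eq_replicate_two_iff hX α).symm

theorem longCycleSum_permCongr {X Y : Type*} [Fintype X] [Fintype Y] (e : X ≃ Y) (x : ℚ)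
    (w : Perm X) : longCycleSum x (e.permCongr w) = longCycleSum x w := by
  classical
  rw [longCycleSum, longCycleSum, Finset.sum_filter, Finset.sum_filter]
  symm
  have key : ∀ γ : Perm X, (∀ a b, SameCycle (e.permCongr γ) a b) ↔ ∀ a b, SameCycle γ a b := by
    intro γ
    exact ⟨fun H a b => (sameCycle_permCongr e γ a b).1 (H _ _), fun H a b => by
      rw [← e.apply_symm_apply a, ← e.apply_symm_apply b, sameCycle_permCongr]
      exact H _ _⟩
  refine Finset.sum_equiv e.permCongr (by simp) fun γ _ => ?_
  have h2 : e.permCongr w * e.permCongr γ = e.permCongr (w * γ) :=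
    (map_mul e.permCongrHom w γ).symm
  rw [h2, numCycles_permCongr]
  simp only [key]

/-- Fixed-point-free involutions share one cycle type, hence are conjugate, and conjugation permutes
the long cycles. -/
theorem longCycleSum_eq_flip {X : Type*} [Fintype X] [DecidableEq X] {n : ℕ}
    (hX : Fintype.card X = 2 * n) (x : ℚ) {α : Perm X} (h1 : ∀ x, α (α x) = x)
    (h2 : ∀ x, α x ≠ x) :
    longCycleSum x α = longCycleSum x (flipOn (Finset.univ : Finset (Fin n))) := by
  have hc : Fintype.card (Fin n × Bool) = Fintype.card X := by
    rw [Fintype.card_prod, Fintype.card_fin, Fintype.card_bool, hX, mul_comm]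
  obtain ⟨e⟩ : Nonempty (Fin n × Bool ≃ X) := ⟨Fintype.equivOfCardEq hc⟩
  have h3 := (cycleType_eq_replicate_two_iff hX α).2 ⟨h1, h2⟩
  have h4 := (cycleType_eq_replicate_two_iff hX
    (e.permCongr (flipOn (Finset.univ : Finset (Fin n))))).2 ⟨fun y => by
      obtain ⟨⟨i, c⟩, rfl⟩ := e.surjective y
      simp [flipOn_of_mem], fun y => by
      obtain ⟨⟨i, c⟩, rfl⟩ := e.surjective y
      simp [flipOn_of_mem]⟩
  obtain ⟨p, hp⟩ := isConj_iff.1 (isConj_iff_cycleType_eq.2 (h4.trans h3.symm))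
  have h5 : p * e.permCongr (flipOn (Finset.univ : Finset (Fin n))) * p⁻¹ =
      p.permCongr (e.permCongr (flipOn Finset.univ)) := rfl
  rw [← hp, h5, longCycleSum_permCongr, longCycleSum_permCongr]

/-! ### Labelled and rooted maps -/

namespace LabelledOneFaceMap

theorem ext_alpha_gamma {n : ℕ} {M N : LabelledOneFaceMap n} (h1 : M.alpha = N.alpha)
    (h2 : M.gamma = N.gamma) : M = N := by
  have h3 : M.beta = N.beta := by
    have h4 := M.gamma_eq
    rw [h1, h2, N.gamma_eq] at h4
    exact (mul_left_cancel h4).symm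
  cases M
  cases N
  simp_all

theorem alpha_mul_self {n : ℕ} (M : LabelledOneFaceMap n) : M.alpha * M.alpha = 1 := by
  ext x
  simp [M.alpha_invol]

theorem beta_eq {n : ℕ} (M : LabelledOneFaceMap n) : M.beta = M.alpha * M.gamma := by
  rw [M.gamma_eq, ← mul_assoc, M.alpha_mul_self, one_mul]

/-- A labelled one-face map is a fixed-point-free involution together with a long cycle. -/
def equivPairs (n : ℕ) : LabelledOneFaceMap n ≃
    {α : Perm (Fin (2 * n)) // (∀ x, α (α x) = x) ∧ ∀ x, α x ≠ x} ×
      {γ : Perm (Fin (2 * n)) // ∀ x y, SameCycle γ x y} where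
  toFun M := (⟨M.alpha, M.alpha_invol, M.alpha_ne⟩, ⟨M.gamma, M.gamma_cycle⟩)
  invFun p :=
    { alpha := p.1.1
      beta := p.1.1⁻¹ * p.2.1
      gamma := p.2.1
      alpha_invol := p.1.2.1
      alpha_ne := p.1.2.2
      gamma_eq := by group
      gamma_cycle := p.2.2 }
  left_inv _ := ext_alpha_gamma rfl rfl
  right_inv _ := rfl

noncomputable instance (n : ℕ) : Fintype (LabelledOneFaceMap n) := by
  classical exact Fintype.ofEquiv _ (equivPairs n).symm

/-- Relabelling of the half-edges. -/
def relabel {n : ℕ} (p : Perm (Fin (2 * n))) (M : LabelledOneFaceMap n) :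
    LabelledOneFaceMap n where
  alpha := p * M.alpha * p⁻¹
  beta := p * M.beta * p⁻¹
  gamma := p * M.gamma * p⁻¹
  alpha_invol x := by simp [M.alpha_invol]
  alpha_ne x h := M.alpha_ne (p⁻¹ x) (by
    rw [Perm.mul_apply, Perm.mul_apply] at h
    exact (Perm.eq_inv_iff_eq).2 h)
  gamma_eq := by rw [M.gamma_eq]; group
  gamma_cycle x y := sameCycle_conj.2 (M.gamma_cycle _ _)

theorem numVertices_relabel {n : ℕ} (p : Perm (Fin (2 * n))) (M : LabelledOneFaceMap n) :
    (relabel p M).numVertices = M.numVertices := by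
  rw [numVertices, numVertices, relabel, numCycles_conj]

theorem sum_pow_numCycles_beta (n : ℕ) (x : ℚ) :
    ∑ M : LabelledOneFaceMap n, x ^ numCycles M.beta =
      ((Finset.univ.filter fun α : Perm (Fin (2 * n)) =>
        (∀ x, α (α x) = x) ∧ ∀ x, α x ≠ x).card : ℚ) *
          longCycleSum x (flipOn (Finset.univ : Finset (Fin n))) := by
  classical
  rw [Fintype.sum_equiv (equivPairs n) _ (fun p => x ^ numCycles (p.1.1 * p.2.1))
    (fun M => by rw [beta_eq]; rfl), Fintype.sum_prod_type]
  have h : ∀ α : {α : Perm (Fin (2 * n)) // (∀ x, α (α x) = x) ∧ ∀ x, α x ≠ x},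
      ∑ γ : {γ : Perm (Fin (2 * n)) // ∀ x y, SameCycle γ x y}, x ^ numCycles (α.1 * γ.1) =
        longCycleSum x (flipOn (Finset.univ : Finset (Fin n))) := by
    intro α
    rw [← longCycleSum_eq_flip (Fintype.card_fin _) x α.2.1 α.2.2, longCycleSum]
    symm
    exact Finset.sum_subtype _ (by simp) _
  rw [Finset.sum_congr rfl fun α _ => h α, Finset.sum_const, nsmul_eq_mul, Finset.card_univ,
    Fintype.card_subtype]

end LabelledOneFaceMap

/-! ### From labelled to rooted maps, and comparison of coefficients -/

open LabelledOneFaceMap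

theorem card_eq_card_quotient_mul {A : Type*} [Finite A] (s : Setoid A) (c : ℕ)
    (h : ∀ a, Nat.card {b // s b a} = c) : Nat.card A = Nat.card (Quotient s) * c := by
  have := Fintype.ofFinite (Quotient s)
  rw [← Nat.card_congr (Equiv.sigmaFiberEquiv (Quotient.mk s)), Nat.card_sigma]
  have h' : ∀ q : Quotient s, Nat.card {b // Quotient.mk s b = q} = c := by
    intro q
    induction q using Quotient.inductionOn with
    | h a => exact (Nat.card_congr (Equiv.subtypeEquivRight fun b => Quotient.eq)).trans (h a)
  simp [h']

theorem card_perm_fixing_root (n : ℕ) :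
    Nat.card {p : Perm (Fin (2 * (n + 1))) // ∀ x : Fin (2 * (n + 1)), x.val = 0 → p x = x} =
      (2 * n + 1).factorial := by
  have e := Perm.subtypeEquivSubtypePerm fun x : Fin (2 * (n + 1)) => x.val ≠ 0
  simp only [not_not, ne_eq] at e
  rw [← Nat.card_congr e, Nat.card_eq_fintype_card, Fintype.card_perm, Fintype.card_subtype_compl,
    Fintype.card_fin]
  have : Fintype.card {x : Fin (2 * (n + 1)) // x.val = 0} = 1 :=
    Fintype.card_eq_one_iff.2 ⟨⟨⟨0, by omega⟩, rfl⟩, fun y => Subtype.ext (Fin.ext y.2)⟩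
  rw [this]
  congr 1

/-- Each class has (2n + 1)! members: if two root-fixing relabellings p, q agree on M, then q⁻¹ p
commutes with the long cycle γ and fixes the root, hence fixes every half-edge. -/
theorem card_labelled_eq (n g : ℕ) :
    Nat.card {M : LabelledOneFaceMap (n + 1) // M.HasGenus g} =
      numRootedOneFaceMaps (n + 1) g * (2 * n + 1).factorial := by
  refine card_eq_card_quotient_mul _ _ fun M => ?_
  rw [← card_perm_fixing_root]
  have hgen : ∀ p, (relabel p M.1).HasGenus g := fun p => by
    rw [HasGenus, numVertices_relabel]
    exact M.2
  refine (Nat.card_eq_of_bijective (fun p => ⟨⟨relabel p.1 M.1, hgen p.1⟩,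
    (rootedMapSetoid (n + 1) g).symm ⟨p.1, rfl, rfl, p.2⟩⟩) ⟨?_, ?_⟩).symm
  · rintro ⟨p, hp⟩ ⟨q, hq⟩ h
    have h1 : p * M.1.gamma * p⁻¹ = q * M.1.gamma * q⁻¹ :=
      congrArg (fun N => N.1.1.gamma) h
    have hc : Commute (q⁻¹ * p) M.1.gamma := by
      have : q⁻¹ * (p * M.1.gamma * p⁻¹) * p = q⁻¹ * (q * M.1.gamma * q⁻¹) * p := by rw [h1]
      rw [commute_iff_eq]
      simpa [mul_assoc] using this
    refine Subtype.ext (Equiv.ext fun x => ?_)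
    obtain ⟨k, rfl⟩ := M.1.gamma_cycle ⟨0, by omega⟩ x
    have h2 := congrArg (fun σ : Perm (Fin (2 * (n + 1))) => σ ⟨0, by omega⟩)
      (hc.zpow_right k).eq
    simp only [Perm.mul_apply] at h2
    have h3 : q⁻¹ (p ⟨0, by omega⟩) = ⟨0, by omega⟩ := by
      rw [hp _ rfl, Perm.inv_eq_iff_eq, hq _ rfl]
    rw [h3, Perm.inv_eq_iff_eq] at h2
    exact h2
  · rintro ⟨⟨N, hN⟩, h⟩
    obtain ⟨p, h1, h2, h3⟩ := (rootedMapSetoid (n + 1) g).symm h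
    exact ⟨⟨p, h3⟩, Subtype.ext (Subtype.ext (ext_alpha_gamma h1.symm h2.symm))⟩

-- The two polynomials agree at all natural numbers N, where `mul_longCycleSum_flip` and
-- `sum_fallingRising_eq` apply.
open Polynomial in
theorem sum_X_pow_numCycles_beta (n : ℕ) :
    C ((n + 2).factorial : ℚ) * (X * ∑ M : LabelledOneFaceMap (n + 1), X ^ numCycles M.beta) =
      C (((Finset.univ.filter fun α : Perm (Fin (2 * (n + 1))) =>
        (∀ x, α (α x) = x) ∧ ∀ x, α x ≠ x).card : ℚ) * (2 * n + 1).factorial) *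
          barPoly (n + 1) := by
  refine eq_of_infinite_eval_eq _ _
    ((Set.infinite_range_of_injective (Nat.cast_injective (R := ℚ))).mono ?_)
  rintro _ ⟨N, rfl⟩
  have h1 := sum_fallingRising_eq n N
  rw [← mul_longCycleSum_flip (ι := Fin (n + 1)) n (Fintype.card_fin _)] at h1
  have h2 := sum_pow_numCycles_beta (n + 1) N
  rw [Set.mem_ofPred_eq, eval_mul, eval_mul, eval_mul, eval_C, eval_C, eval_X, eval_barPoly,
    eval_finsetSum]
  simp only [eval_pow, eval_X]
  rw [h2, mul_assoc, ← h1]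
  ring

theorem numRootedOneFaceMaps_zero (g : ℕ) :
    (numRootedOneFaceMaps 0 g : ℚ) = if g = 0 then 1 else 0 := by
  have hu : ∀ M N : LabelledOneFaceMap 0, M = N := fun M N =>
    ext_alpha_gamma (Equiv.ext fun x => x.elim0) (Equiv.ext fun x => x.elim0)
  have hg : ∀ M : LabelledOneFaceMap 0, M.HasGenus g ↔ g = 0 := fun M => by
    rw [HasGenus, numVertices, if_pos rfl]
    omega
  split_ifs with h
  · have M : LabelledOneFaceMap 0 :=
      ⟨1, 1, 1, fun x => x.elim0, fun x => x.elim0, rfl, fun x => x.elim0⟩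
    rw [numRootedOneFaceMaps, Nat.cast_eq_one, Nat.card_eq_one_iff_unique]
    refine ⟨⟨fun a b => ?_⟩, ⟨⟦⟨M, (hg M).2 h⟩⟧⟩⟩
    induction a using Quotient.inductionOn
    induction b using Quotient.inductionOn
    exact congrArg _ (Subtype.ext (hu _ _))
  · have : IsEmpty (Quotient (rootedMapSetoid 0 g)) := by
      refine ⟨fun q => ?_⟩
      induction q using Quotient.inductionOn with
      | h M => exact h ((hg M.1).1 M.2)
    rw [numRootedOneFaceMaps, Nat.card_of_isEmpty, Nat.cast_zero]

theorem barA_zero (g : ℕ) : barA 0 g = if g = 0 then 1 else 0 := by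
  have hP : barPoly 0 = Polynomial.X ^ 2 := by
    simp [barPoly, risingPoly, fallingPoly, pow_two]
  rcases g with _ | _ | g
  · rw [barA_eq_coeff (d := 2) rfl, hP, if_pos rfl, Polynomial.coeff_X_pow, if_pos rfl]
  · rw [barA_eq_coeff (d := 0) rfl, hP, Polynomial.coeff_X_pow]
    simp
  · rw [barA_eq_zero (by omega), if_neg (by omega)]

/-- With n + 1 edges, Euler's formula reads v + 1 = d; the extra factor X accounts for the shift by
one. -/
theorem card_labelled_hasGenus {n g d : ℕ} (h : d + 2 * g = n + 3) :
    (Nat.card {M : LabelledOneFaceMap (n + 1) // M.HasGenus g} : ℚ) =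
      (Polynomial.X * ∑ M : LabelledOneFaceMap (n + 1),
        (Polynomial.X : Polynomial ℚ) ^ numCycles M.beta).coeff d := by
  cases d with
  | zero =>
    rw [Polynomial.coeff_X_mul_zero, Nat.cast_eq_zero, Nat.card_eq_zero]
    refine Or.inl ⟨fun M => ?_⟩
    have := M.2
    rw [HasGenus] at this
    push_cast at this
    omega
  | succ d =>
    rw [Polynomial.coeff_X_mul, coeff_sum_X_pow, Nat.cast_inj]
    refine Nat.card_congr (Equiv.subtypeEquivRight fun M => ?_)
    rw [HasGenus, numVertices, if_neg (Nat.succ_ne_zero n)]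
    push_cast
    omega

theorem mainTheorem2 (n g : ℕ) :
    (numRootedOneFaceMaps n g : ℚ) =
      ((2 * n).factorial : ℚ) / (2 ^ n * (n.factorial : ℚ) * ((n + 1).factorial : ℚ)) *
        barA n g := by
  rcases n with _ | n
  · rw [numRootedOneFaceMaps_zero, barA_zero]
    simp
  have hA := card_labelled_eq n g
  have hF : ((2 * n + 1).factorial : ℚ) ≠ 0 := Nat.cast_ne_zero.2 (Nat.factorial_ne_zero _)
  rcases lt_or_ge (n + 3) (2 * g) with hlt | hle
  · rw [barA_eq_zero (by omega), mul_zero, Nat.cast_eq_zero]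
    have hE : Nat.card {M : LabelledOneFaceMap (n + 1) // M.HasGenus g} = 0 := by
      refine Nat.card_eq_zero.2 (Or.inl ⟨fun M => ?_⟩)
      have := M.2
      rw [HasGenus] at this
      push_cast at this
      omega
    rw [hE] at hA
    exact (mul_eq_zero.1 hA.symm).resolve_right (Nat.factorial_ne_zero _)
  · obtain ⟨d, hd⟩ := Nat.exists_eq_add_of_le' hle
    have h1 := congrArg (fun p => p.coeff d) (sum_X_pow_numCycles_beta n)
    simp only [Polynomial.coeff_C_mul] at h1
    -- The factor (2n + 1)! now occurs on both sides, from the root-fixing relabellings and from the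
    -- power series evaluation, and is cancelled below.
    rw [← card_labelled_hasGenus hd.symm, hA, ← barA_eq_coeff (g := g) (by omega)] at h1
    have h2 : ((Finset.univ.filter fun α : Perm (Fin (2 * (n + 1))) =>
        (∀ x, α (α x) = x) ∧ ∀ x, α x ≠ x).card : ℚ) * (2 ^ (n + 1) * (n + 1).factorial) =
          (2 * (n + 1)).factorial := by
      exact_mod_cast card_fixedPointFree_involutions (Fintype.card_fin (2 * (n + 1)))
    push_cast at h1
    have h3 : ((n + 2).factorial : ℚ) ≠ 0 := Nat.cast_ne_zero.2 (Nat.factorial_ne_zero _)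
    have h4 : ((n + 1).factorial : ℚ) ≠ 0 := Nat.cast_ne_zero.2 (Nat.factorial_ne_zero _)
    have h5 : (2 : ℚ) ^ (n + 1) ≠ 0 := by positivity
    rw [← h2, div_mul_eq_mul_div, eq_div_iff (mul_ne_zero (mul_ne_zero h5 h4) h3)]
    refine mul_right_cancel₀ hF ?_
    linear_combination (2 ^ (n + 1) * (n + 1).factorial : ℚ) * h1
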